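/- All structures, graphs and trees are finite. Let $\Sigma$ be a finite relational signature. \emph{Incidence structures.} For a $\Sigma$-structure $\mathfrak A$ with domain $A$, let $E=\bigcup_{R\in\Sigma}R^{\mathfrak A}$ be the set of all tuples occurring in its relations. The incidence structure $\mathfrak A_{\mathrm{in}}$ has domain $A\,\dot\cup\,E$, a unary relation $P_R=\{\bar c\in E: \bar c\in R^{\mathfrak A}\}$ for each $R\in\Sigma$, and, for each $i$ smaller than the maximal arity of a symbol of $\Sigma$, the binary relation $\mathrm{in}_i=\{(a,\bar c)\in A\times E: |\bar c|>i,\ a=c_i\}$. For a class $\mathcal C$ put $\mathcal C_{\mathrm{in}}=\{\mathfrak A_{\mathrm{in}}:\mathfrak A\in\mathcal C\}$. \emph{Transductions.} A (monadic second-order) transduction is a many-valued operation $\tau=\tau_0\circ\mathrm{copy}_k\circ\mathrm{exp}_m$ with $k\ge 1$, $m\ge 0$. Here $\mathrm{exp}_m$ expands a structure by $m$ arbitrary unary predicates. For $k\geq 2$, $\mathrm{copy}_k$ forms the disjoint union of $k$ copies of a structure, expanded by unary predicates $P_0,\dots,P_{k-1}$ for the $k$ copies and by the binary relation $\sim$ relating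 any two copies of the same element; $\mathrm{copy}_1$ is the identity. Finally, $\tau_0$ is given by MSO-formulae $\chi,\delta(x),(\varphi_R(\bar x))_R$: it is defined on those $\mathfrak B$ with $\mathfrak B\models\chi$, and its value is the structure with domain $D=\{b:\mathfrak B\models\delta(b)\}$ and relations $R=\{\bar b\in D^{\mathrm{ar}(R)}:\mathfrak B\models\varphi_R(\bar b)\}$. Structures are considered up to isomorphism, and $\tau(\mathcal K)$ is the class of all values of $\tau$ on members of $\mathcal K$. Write $\mathcal C\sqsubseteq_{\mathrm{in}}\mathcal K$ if there is a transduction $\tau$ with $\mathcal C_{\mathrm{in}}\subseteq\tau(\mathcal K_{\mathrm{in}})$. \emph{Trees.} A tree is a finite prefix-closed set $T$ of finite sequences (possibly empty), regarded as a structure $\langle T,\mathrm{edg}\rangle$ with the successor relation $\mathrm{edg}=\{(x,xd): x,xd\in T\}$. Its height is the least number greater than the length of every element of $T$. Let $\mathcal T_\omega$ be the class of all trees, $\mathcal P$ the class of all paths (trees in which every vertex has at most one successor), and, for $n\in\mathbb N$, let $\mathcal T_n$ be the class of all complete trees $m^{<n}$ (all sequences over $\{0,\dots,m-1\}$ of length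 less than $n$), $m\in\mathbb N$. \emph{Width.} A tree decomposition of $\mathfrak A$ with underlying tree $T$ is a family $(U_v)_{v\in T}$ of subsets of $A$ such that for every $a\in A$ the set $\{v\in T:a\in U_v\}$ is nonempty and connected in $T$, and every tuple of every relation of $\mathfrak A$ has all its components in some $U_v$. Its width is $\sup_{v\in T}(|U_v|-1)$. The tree-width $\mathrm{twd}(\mathfrak A)$, the path-width $\mathrm{pwd}(\mathfrak A)$ and the $n$-depth tree-width $\mathrm{twd}_n(\mathfrak A)$ are the minimal width of a tree decomposition of $\mathfrak A$ whose underlying tree is, respectively, arbitrary, a path, of height at most $n$ (and $\infty$ if there is no such decomposition). For a class $\mathcal C$, $\mathrm{twd}(\mathcal C)$, $\mathrm{pwd}(\mathcal C)$ and $\mathrm{twd}_n(\mathcal C)$ are the suprema of these numbers over $\mathfrak A\in\mathcal C$. \textbf{Theorem.} For every class $\mathcal C$ of (finite) $\Sigma$-structures: (a) $\mathcal C\sqsubseteq_{\mathrm{in}}\mathcal P$ if and only if $\mathrm{pwd}(\mathcal C)<\infty$; (b) $\mathcal C\sqsubseteq_{\mathrm{in}}\mathcal T_\omega$ if and only if $\mathrm{twd}(\mathcal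 C)<\infty$; (c) for every $n\in\mathbb N$, $\mathcal C\sqsubseteq_{\mathrm{in}}\mathcal T_n$ if and only if $\mathrm{twd}_n(\mathcal C)<\infty$. -/

import Mathlib

universe u v w u' v' w'

namespace TransductionHierarchy



/-! ### Finite relational structures -/

/-- A finite `L`-structure. (`L` will always be a relational language.) -/
structure FinStr (L : FirstOrder.Language.{u, v}) where
  carrier : Type w
  [str : L.Structure carrier]
  [fin : Finite carrier]

attribute [instance] FinStr.str FinStr.fin

/-! ### Incidence structures -/

/-- The relation symbols of the incidence signature of `L`: a unary `P_R` for every relation symbol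
`R`, and a binary `in_i` for every `i` below the maximal arity of the relation symbols of `L`. -/
inductive IncRel (L : FirstOrder.Language.{u, v}) : ℕ → Type v
  | pred {n : ℕ} (R : L.Relations n) : IncRel L 1
  | inc (i : ℕ) (hi : ∃ n, i < n ∧ Nonempty (L.Relations n)) : IncRel L 2

/-- The incidence signature of `L`. -/
def incLang (L : FirstOrder.Language.{u, v}) : FirstOrder.Language.{0, v} := ⟨fun _ => Empty, IncRel L⟩

instance (L : FirstOrder.Language.{u, v}) : (incLang L).IsRelational := fun _ =>
  inferInstanceAs (IsEmpty Empty)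

/-- The set `E` of all tuples that belong to at least one relation of `A`. A tuple that belongs to
several relations is a single element of `E`. -/
def Tuples (L : FirstOrder.Language.{u, v}) (A : Type w) [L.Structure A] : Type w :=
  {c : Σ n, (Fin n → A) // ∃ R : L.Relations c.1, FirstOrder.Language.Structure.RelMap R c.2}

instance (L : FirstOrder.Language.{u, v}) [Finite (Σ n, L.Relations n)] (A : Type w) [L.Structure A]
    [Finite A] : Finite (Tuples L A) := by
  let S := {q : Σ R : (Σ n, L.Relations n), (Fin R.1 → A) // FirstOrder.Language.Structure.RelMap q.1.2 q.2}
  let f : S → Tuples L A := fun q => ⟨⟨q.1.1.1, q.1.2⟩, ⟨q.1.1.2, q.2⟩⟩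
  refine Finite.of_surjective f ?_
  rintro ⟨⟨n, c⟩, R, h⟩
  exact ⟨⟨⟨⟨n, R⟩, c⟩, h⟩, rfl⟩

/-- The relations of the incidence structure, on the domain `A ⊕ E`. -/
instance incStructure (L : FirstOrder.Language.{u, v}) (A : Type w) [L.Structure A] :
    (incLang L).Structure (A ⊕ Tuples L A) where
  funMap f := nomatch f
  RelMap R x := match R with
    | .pred (n := n) R =>
        ∃ (e : Tuples L A) (c : Fin n → A),
          x 0 = Sum.inr e ∧ e.1 = ⟨n, c⟩ ∧ FirstOrder.Language.Structure.RelMap R c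
    | .inc i _ =>
        ∃ (a : A) (e : Tuples L A) (h : i < e.1.1),
          x 0 = Sum.inl a ∧ x 1 = Sum.inr e ∧ a = e.1.2 ⟨i, h⟩

/-- The incidence structure `A_in` of a finite structure `A`. -/
def FinStr.incidence {L : FirstOrder.Language.{u, v}} [Finite (Σ n, L.Relations n)]
    (A : FinStr.{u, v, w} L) : FinStr.{0, v, w} (incLang L) where
  carrier := A.carrier ⊕ Tuples L A.carrier

/-! ### Monadic second-order logic -/

/-- Monadic second-order formulae over the relation symbols of `L` with set variables only, the free
variables being indexed by `Fin n`. First-order variables are set variables that denote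
singletons. -/
inductive MSO (L : FirstOrder.Language.{u, v}) : ℕ → Type v
  | falsum {n : ℕ} : MSO L n
  | subset {n : ℕ} (X Y : Fin n) : MSO L n
  | rel {n k : ℕ} (R : L.Relations k) (Z : Fin k → Fin n) : MSO L n
  | imp {n : ℕ} (φ ψ : MSO L n) : MSO L n
  | all {n : ℕ} (φ : MSO L (n + 1)) : MSO L n

/-- Satisfaction of a formula under an assignment of subsets of `A` to its free variables. -/
def MSO.Realize {L : FirstOrder.Language.{u, v}} {A : Type w} [L.Structure A] :
    {n : ℕ} → MSO L n → (Fin n → Set A) → Prop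
  | _, .falsum, _ => False
  | _, .subset X Y, s => s X ⊆ s Y
  | _, .rel (k := k) R Z, s =>
      ∃ a : Fin k → A, (∀ i, a i ∈ s (Z i)) ∧ FirstOrder.Language.Structure.RelMap R a
  | _, .imp φ ψ, s => φ.Realize s → ψ.Realize s
  | n, .all φ, s => ∀ X : Set A, φ.Realize (Fin.snoc (α := fun _ : Fin (n + 1) => Set A) s X)

/-! ### Transductions -/

/-- The symbols of `L` and `m` further unary symbols. -/
inductive ExpRel (L : FirstOrder.Language.{u, v}) (m : ℕ) : ℕ → Type v
  | base {n : ℕ} (R : L.Relations n) : ExpRel L m n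
  | param (i : Fin m) : ExpRel L m 1

/-- The signature of the expansions by `m` unary predicates. -/
def expLang (L : FirstOrder.Language.{u, v}) (m : ℕ) : FirstOrder.Language.{0, v} := ⟨fun _ => Empty, ExpRel L m⟩

/-- The expansion of `A` by the unary predicates `Q i`. -/
def FinStr.expand {L : FirstOrder.Language.{u, v}} (A : FinStr.{u, v, w} L) {m : ℕ}
    (Q : Fin m → Set A.carrier) : FinStr.{0, v, w} (expLang L m) where
  carrier := A.carrier
  str :=
    { funMap := fun f => nomatch f
      RelMap := fun R x => match R with
        | .base R => FirstOrder.Language.Structure.RelMap R x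
        | .param i => x 0 ∈ Q i }

/-- The symbols of `L` and, if `k ≥ 2`, a binary symbol `∼` and unary symbols `P i`, `i < k`. -/
inductive CopyRel (L : FirstOrder.Language.{u, v}) (k : ℕ) : ℕ → Type v
  | base {n : ℕ} (R : L.Relations n) : CopyRel L k n
  | sim (hk : 2 ≤ k) : CopyRel L k 2
  | part (hk : 2 ≤ k) (i : Fin k) : CopyRel L k 1

/-- The signature of `copy_k(A)`. -/
def copyLang (L : FirstOrder.Language.{u, v}) (k : ℕ) : FirstOrder.Language.{0, v} := ⟨fun _ => Empty, CopyRel L k⟩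

/-- `copy_k(A)`: the disjoint union of `k` copies of `A`, where `(a, i)` is the copy of `a` in the
`i`-th component. For `k = 1` it is (a copy of) `A` with no further relations. -/
def FinStr.copy {L : FirstOrder.Language.{u, v}} (k : ℕ) (A : FinStr.{u, v, w} L) :
    FinStr.{0, v, w} (copyLang L k) where
  carrier := A.carrier × Fin k
  str :=
    { funMap := fun f => nomatch f
      RelMap := fun R x => match R with
        | .base R => (∃ i, ∀ j, (x j).2 = i) ∧ FirstOrder.Language.Structure.RelMap R (fun j => (x j).1)
        | .sim _ => (x 0).1 = (x 1).1
        | .part _ i => (x 0).2 = i }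

/-- The definition scheme of a basic MSO-transduction from `L`-structures to `L'`-structures. -/
structure BasicTransduction (L : FirstOrder.Language.{u, v}) (L' : FirstOrder.Language.{u', v'}) where
  chi : MSO L 0
  delta : MSO L 1
  phi : {n : ℕ} → L'.Relations n → MSO L n

namespace BasicTransduction

variable {L : FirstOrder.Language.{u, v}} {L' : FirstOrder.Language.{u', v'}}

/-- The basic transduction is defined on `A`. -/
def Defined (τ : BasicTransduction L L') (A : FinStr.{u, v, w} L) : Prop :=
  τ.chi.Realize (A := A.carrier) Fin.elim0

/-- The output of a basic transduction. -/
def apply [L'.IsRelational] (τ : BasicTransduction L L') (A : FinStr.{u, v, w} L) :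
    FinStr.{u', v', w} L' where
  carrier := {a : A.carrier // τ.delta.Realize (fun _ => {a})}
  str :=
    { funMap := fun f => isEmptyElim f
      RelMap := fun R x => (τ.phi R).Realize (fun i => ({(x i).1} : Set A.carrier)) }

end BasicTransduction

/-- A (`k`-copying, `m`-parameter) MSO-transduction `τ₀ ∘ copy_k ∘ exp_m`. -/
structure Transduction (L : FirstOrder.Language.{u, v}) (L' : FirstOrder.Language.{u', v'}) where
  params : ℕ
  copies : ℕ
  one_le_copies : 1 ≤ copies
  basic : BasicTransduction (copyLang (expLang L params) copies) L'

/-- `τ(A)`: the set of all structures that are, up to isomorphism, values of the many-valued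
operation `τ` on `A`. -/
def Transduction.values {L : FirstOrder.Language.{u, v}} {L' : FirstOrder.Language.{u', v'}} [L'.IsRelational]
    (τ : Transduction L L') (A : FinStr.{u, v, w} L) : Set (FinStr.{u', v', w'} L') :=
  {B | ∃ Q : Fin τ.params → Set A.carrier,
    τ.basic.Defined ((A.expand Q).copy τ.copies) ∧
      Nonempty (FirstOrder.Language.Equiv L' (τ.basic.apply ((A.expand Q).copy τ.copies)).carrier B.carrier)}

/-- `τ(K)`, the union of all `τ(A)` for `A ∈ K`. -/
def Transduction.image {L : FirstOrder.Language.{u, v}} {L' : FirstOrder.Language.{u', v'}} [L'.IsRelational]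
    (τ : Transduction L L') (K : Set (FinStr.{u, v, w} L)) : Set (FinStr.{u', v', w'} L') :=
  ⋃ A ∈ K, τ.values A

/-- `C ⊑ K`: `C ⊆ τ(K)` for some transduction `τ`. -/
def Below {L' : FirstOrder.Language.{u', v'}} {L : FirstOrder.Language.{u, v}} [L'.IsRelational]
    (C : Set (FinStr.{u', v', w'} L')) (K : Set (FinStr.{u, v, w} L)) : Prop :=
  ∃ τ : Transduction L L', C ⊆ τ.image K

/-- `C ⊑_in K`: `C_in ⊑ K_in`. -/
def BelowIn {L' : FirstOrder.Language.{u', v'}} {L : FirstOrder.Language.{u, v}}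
    [Finite (Σ n, L'.Relations n)] [Finite (Σ n, L.Relations n)]
    (C : Set (FinStr.{u', v', w'} L')) (K : Set (FinStr.{u, v, w} L)) : Prop :=
  Below (FinStr.incidence '' C) (FinStr.incidence '' K)

/-! ### Trees -/

/-- A finite rooted tree, as a finite prefix-closed set of finite sequences. The root is `[]`. The
empty tree is allowed. -/
structure TreeDom where
  verts : Finset (List ℕ)
  prefix_closed : ∀ x y : List ℕ, x <+: y → y ∈ verts → x ∈ verts

namespace TreeDom

/-- The successor relation. -/
def edg (T : TreeDom) (x y : T.verts) : Prop := ∃ d : ℕ, y.1 = x.1 ++ [d]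

/-- The undirected graph underlying the tree. -/
def graph (T : TreeDom) : SimpleGraph T.verts := SimpleGraph.fromRel T.edg

/-- The height: the least number greater than the level (the length) of every vertex. -/
def height (T : TreeDom) : ℕ := T.verts.sup (fun x => x.length + 1)

/-- The tree is a path (starting at the root): every vertex has at most one successor. -/
def IsPath (T : TreeDom) : Prop :=
  ∀ x y z : T.verts, T.edg x y → T.edg x z → y = z

/-- The complete `m`-ary tree `m^{<n}` of height `n`. -/
noncomputable def complete (m n : ℕ) : TreeDom where
  verts := ((List.finite_length_lt (Fin m) n).image (List.map Fin.val)).toFinset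
  prefix_closed := by
    intro x y hxy hy
    simp only [Set.Finite.mem_toFinset, Set.mem_image, Set.mem_ofPred_eq] at hy ⊢
    obtain ⟨l, hl, rfl⟩ := hy
    refine ⟨l.take x.length, ?_, ?_⟩
    · exact lt_of_le_of_lt (by simp) hl
    · rw [List.map_take]
      exact (List.prefix_iff_eq_take.mp hxy).symm

/-- The successor-tree `⟨T, edg⟩` as a structure over the signature with a single binary symbol. -/
def toFinStr (T : TreeDom) : FinStr.{0, 0, 0} FirstOrder.Language.graph where
  carrier := T.verts
  str :=
    { funMap := fun f => nomatch f
      RelMap := fun R x => match R with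
        | .adj => T.edg (x 0) (x 1) }

end TreeDom

instance : Finite (Σ n, FirstOrder.Language.graph.Relations n) := by
  refine Finite.of_surjective
    (fun _ : Unit => (⟨2, FirstOrder.Language.adj⟩ : Σ n, FirstOrder.Language.graph.Relations n)) ?_
  rintro ⟨_, ⟨⟩⟩
  exact ⟨(), rfl⟩

/-- `T_n`, the class of all complete trees `m^{<n}`, `m ∈ ℕ`. -/
def treesOfHeight (n : ℕ) : Set (FinStr.{0, 0, 0} FirstOrder.Language.graph) :=
  Set.range fun m => (TreeDom.complete m n).toFinStr

/-- `T_ω`, the class of all trees. -/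
def allTrees : Set (FinStr.{0, 0, 0} FirstOrder.Language.graph) := Set.range TreeDom.toFinStr

/-- `P`, the class of all paths. -/
def allPaths : Set (FinStr.{0, 0, 0} FirstOrder.Language.graph) := TreeDom.toFinStr '' {T | T.IsPath}

/-! ### Tree decompositions and width -/

/-- A tree decomposition of `A` with underlying tree `T`. (`Connected` includes being nonempty.) -/
structure TreeDecomp {L : FirstOrder.Language.{u, v}} (T : TreeDom) (A : FinStr.{u, v, w} L) where
  bag : T.verts → Set A.carrier
  connected : ∀ a, (T.graph.induce {t | a ∈ bag t}).Connected
  covers : ∀ {n : ℕ} (R : L.Relations n) (c : Fin n → A.carrier),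
    FirstOrder.Language.Structure.RelMap R c → ∃ t, ∀ i, c i ∈ bag t

variable {L : FirstOrder.Language.{u, v}}

/-- The width: the supremum of `|U_t| - 1` over all vertices `t`. -/
noncomputable def TreeDecomp.width {T : TreeDom} {A : FinStr.{u, v, w} L}
    (D : TreeDecomp T A) : EReal :=
  ⨆ t, (((D.bag t).ncard : EReal) - 1)

/-- Tree-width of a structure. -/
noncomputable def twd (A : FinStr.{u, v, w} L) : EReal :=
  ⨅ (T : TreeDom) (D : TreeDecomp T A), D.width

/-- Path-width of a structure. -/
noncomputable def pwd (A : FinStr.{u, v, w} L) : EReal :=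
  ⨅ (T : TreeDom) (_ : T.IsPath) (D : TreeDecomp T A), D.width

/-- `n`-depth tree-width of a structure (`⊤` if there is no decomposition of height at most
`n`). -/
noncomputable def twdDepth (n : ℕ) (A : FinStr.{u, v, w} L) : EReal :=
  ⨅ (T : TreeDom) (_ : T.height ≤ n) (D : TreeDecomp T A), D.width

/-- Tree-width of a class. -/
noncomputable def twdClass (C : Set (FinStr.{u, v, w} L)) : EReal := ⨆ A ∈ C, twd A

/-- Path-width of a class. -/
noncomputable def pwdClass (C : Set (FinStr.{u, v, w} L)) : EReal := ⨆ A ∈ C, pwd A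

/-- `n`-depth tree-width of a class. -/
noncomputable def twdDepthClass (n : ℕ) (C : Set (FinStr.{u, v, w} L)) : EReal :=
  ⨆ A ∈ C, twdDepth n A

end TransductionHierarchy

open TransductionHierarchy

namespace TransductionHierarchy

/-! Both directions keep the underlying tree. For any set `𝒯` of trees, `belowIn_iff` equates
transductions from the incidence structures of trees in `𝒯` with decompositions over trees in `𝒯`
whose bags have uniformly bounded size. The three claims are instances. `iSup_width_lt_top_iff`
translates bounded bags into finite width, and `TreeDecomp.exists_extend` passes from trees of
bounded height to complete trees by adding empty bags.

From transductions to decompositions (`exists_treeDecomp_of_belowIn`): elements and tuples of the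
output are copies of vertices or edges of the tree `T`, so they have locations in `T`. An element
`a` is put into the bag of its own location and of every vertex on the path from there to the
location of a tuple containing `a`. Connectedness and covering are then immediate. The size of the
bag at `x` is bounded by a composition argument (`realize_of_tp_eq`): deleting `x` splits the
structure into parts, and parts of equal type can be exchanged without changing the truth of
formulae of bounded rank. If `a` and `a'` have the same types and `e` lies in neither of their
parts, then `a'` can replace `a` as the `i`-th component of `e`. As a tuple has only one `i`-th
component, each type occurs at most twice among the elements counted (`IsStar.ncard_le`).

From decompositions to transductions (`incidence_mem_values`): colour the elements with `K` colours,
injectively on every bag. An element is stored at a vertex whose bag contains it, in the copy given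
by its colour; a tuple is stored at a vertex whose bag contains all its components, in the copy
given by their colours and by its relations. The regions of distinct elements of one colour are
disjoint, and parameters mark the edges inside them. So `a` is the component of its colour of a
tuple exactly when their positions are connected inside such regions, which is expressible in MSO.
-/

/-! ### Types of set assignments -/

/-- The quantifier rank of a formula. -/
def MSO.rank {L : FirstOrder.Language.{u, v}} : {n : ℕ} → MSO L n → ℕ
  | _, .falsum => 0
  | _, .subset _ _ => 0
  | _, .rel _ _ => 0
  | _, .imp φ ψ => max φ.rank ψ.rank
  | _, .all φ => φ.rank + 1

/-- The rank-`r` types of `n` sets, when `F n` is the set of rank-`0` types of `n` sets. -/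
def Ty (F : ℕ → Type) : ℕ → ℕ → Type
  | 0, n => F n
  | r + 1, n => F n × Set (Ty F r (n + 1))

instance Ty.finite (F : ℕ → Type) [∀ n, Finite (F n)] : ∀ r n, Finite (Ty F r n)
  | 0, n => inferInstanceAs (Finite (F n))
  | r + 1, n =>
    haveI := Ty.finite F r (n + 1)
    inferInstanceAs (Finite (F n × Set (Ty F r (n + 1))))

/-- The rank-`r` type of an assignment. -/
def tp {F : ℕ → Type} {M : Type w} (view : ∀ n, (Fin n → Set M) → F n) :
    ∀ r n, (Fin n → Set M) → Ty F r n
  | 0, n, s => view n s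
  | r + 1, n, s =>
    (view n s, Set.range fun X : Set M =>
      tp view r (n + 1) (Fin.snoc (α := fun _ : Fin (n + 1) => Set M) s X))

section Types

variable {F : ℕ → Type} {M : Type w} {I : Type w'} (comp : M → I)
  (view : I → ∀ n, (Fin n → Set M) → F n)

/-- The type of a part depends only on the sets inside that part. -/
theorem tp_congr
    (hloc : ∀ i n (s s' : Fin n → Set M), (∀ j m, comp m = i → (m ∈ s j ↔ m ∈ s' j)) →
      view i n s = view i n s') (i : I) :
    ∀ r n (s s' : Fin n → Set M), (∀ j m, comp m = i → (m ∈ s j ↔ m ∈ s' j)) →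
      tp (view i) r n s = tp (view i) r n s'
  | 0, n, s, s', h => hloc i n s s' h
  | r + 1, n, s, s', h => by
    have : ∀ X : Set M,
        tp (view i) r (n + 1) (Fin.snoc (α := fun _ : Fin (n + 1) => Set M) s X) =
        tp (view i) r (n + 1) (Fin.snoc (α := fun _ : Fin (n + 1) => Set M) s' X) := by
      intro X
      refine tp_congr hloc i r (n + 1) _ _ fun j m hm => ?_
      refine Fin.lastCases ?_ (fun j => ?_) j
      · simp
      · simpa using h j m hm
    exact Prod.ext (hloc i n s s' h) (congrArg Set.range (funext this))

theorem view_eq_of_tp_eq {i i' : I} {r n : ℕ} {s s' : Fin n → Set M}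
    (h : tp (view i) r n s = tp (view i') r n s') : view i n s = view i' n s' := by
  cases r with
  | zero => exact h
  | succ r => exact congrArg Prod.fst h

/-- If the parts of `(M, s)` and those of `(M, s')` can be matched so that matching parts have the
same type, then `(M, s)` and `(M, s')` satisfy the same formulae. -/
theorem realize_of_tp_eq {L : FirstOrder.Language.{u, v}} [L.Structure M]
    (hloc : ∀ i n (s s' : Fin n → Set M), (∀ j m, comp m = i → (m ∈ s j ↔ m ∈ s' j)) →
      view i n s = view i n s')
    (hsub : ∀ (σ : Equiv.Perm I) n (s s' : Fin n → Set M),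
      (∀ i, view i n s = view (σ i) n s') → ∀ X Y, s X ⊆ s Y → s' X ⊆ s' Y)
    (i₀ : I) (hrel : ∀ (σ : Equiv.Perm I), σ i₀ = i₀ → ∀ n (s s' : Fin n → Set M),
      (∀ i, view i n s = view (σ i) n s') → ∀ (k : ℕ) (R : L.Relations k) (Z : Fin k → Fin n),
        (MSO.rel R Z).Realize s → (MSO.rel R Z).Realize s')
    {n : ℕ} (φ : MSO L n) : ∀ (σ : Equiv.Perm I) (r : ℕ) (s s' : Fin n → Set M), σ i₀ = i₀ → φ.rank ≤ r →
      (∀ i, tp (view i) r n s = tp (view (σ i)) r n s') → φ.Realize s → φ.Realize s' := by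
  induction φ with
  | falsum => exact fun _ _ _ _ _ _ _ h => h
  | subset X Y => exact fun σ r s s' _ _ h => hsub σ _ s s' (fun i => view_eq_of_tp_eq view (h i)) X Y
  | rel R Z => exact fun σ r s s' h0 _ h => hrel σ h0 _ s s' (fun i => view_eq_of_tp_eq view (h i)) _ R Z
  | imp φ ψ ihφ ihψ =>
    intro σ r s s' h0 hr h hs hφ
    -- The premise has to be transferred from `s'` back to `s`, hence along `σ.symm`.
    refine ihψ σ r s s' h0 ((le_max_right _ _).trans hr) h
      (hs (ihφ σ.symm r s' s (σ.symm_apply_eq.mpr h0.symm) ((le_max_left _ _).trans hr) (fun i => ?_) hφ))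
    have := h (σ.symm i)
    rw [Equiv.apply_symm_apply] at this
    exact this.symm
  | all φ ih =>
    rename_i n
    intro σ r s s' h0 hr h hs Y
    cases r with
    | zero => simp [MSO.rank] at hr
    | succ r =>
      have hX : ∀ i, ∃ X : Set M,
          tp (view i) r (n + 1) (Fin.snoc (α := fun _ : Fin (n + 1) => Set M) s X) =
          tp (view (σ i)) r (n + 1) (Fin.snoc (α := fun _ : Fin (n + 1) => Set M) s' Y) := by
        intro i
        have h2 := congrArg Prod.snd (h i)
        simp only [tp] at h2
        exact (Set.ext_iff.mp h2 _).mpr ⟨Y, rfl⟩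
      choose X hX using hX
      -- Each part `i` has its own set `X i` answering `Y` on the part `σ i`. By locality these can
      -- be glued into one set, taking from `X i` only what lies in part `i`.
      refine ih σ r _ _ h0 (Nat.le_of_succ_le_succ hr) (fun i => ?_) (hs {m | m ∈ X (comp m)})
      rw [← hX i]
      refine tp_congr comp view hloc i r (n + 1) _ _ fun j m hm => ?_
      refine Fin.lastCases ?_ (fun j => ?_) j
      · simp [hm]
      · simp

end Types

/-! ### Structures with a centre whose deletion separates the parts -/

section Star

variable {M : Type w} {J : Type w'} {κ B : Type} (kind : M → κ) (Rb : B → M → M → Prop)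
  (comp : M → Option J)

/-- The kind of an element together with the indices of the sets that contain it. -/
def colour {n : ℕ} (s : Fin n → Set M) (m : M) : κ × Set (Fin n) := (kind m, {j | m ∈ s j})

/-- The rank-`0` types of parts. -/
abbrev StarView (κ B : Type) (n : ℕ) : Type :=
  Set (κ × Set (Fin n)) × Set (B × (κ × Set (Fin n)) × (κ × Set (Fin n))) ×
    Set (B × κ × (κ × Set (Fin n))) × Set (B × κ × (κ × Set (Fin n)))

/-- The rank-`0` type of a part: the colours of its elements, the coloured pairs inside the part,
and the coloured pairs that link it with the centre. -/
def starView (i : Option J) (n : ℕ) (s : Fin n → Set M) : StarView κ B n :=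
  (colour kind s '' {m | comp m = i},
   {q | ∃ m m', comp m = i ∧ comp m' = i ∧ Rb q.1 m m' ∧
      q.2.1 = colour kind s m ∧ q.2.2 = colour kind s m'},
   {q | ∃ m m', comp m = none ∧ comp m' = i ∧ Rb q.1 m m' ∧
      q.2.1 = kind m ∧ q.2.2 = colour kind s m'},
   {q | ∃ m m', comp m = none ∧ comp m' = i ∧ Rb q.1 m' m ∧
      q.2.1 = kind m ∧ q.2.2 = colour kind s m'})

/-- Links with the centre record only the `kind` of the central element, not the sets that contain
it; this keeps the view local to its part. -/
theorem starView_congr (i : Option J) (n : ℕ) (s s' : Fin n → Set M)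
    (h : ∀ j m, comp m = i → (m ∈ s j ↔ m ∈ s' j)) :
    starView kind Rb comp i n s = starView kind Rb comp i n s' := by
  have hc : ∀ m, comp m = i → colour kind s m = colour kind s' m := by
    intro m hm
    simp only [colour, Prod.mk.injEq, true_and]
    ext j
    exact h j m hm
  unfold starView
  refine Prod.ext ?_ (Prod.ext ?_ (Prod.ext ?_ ?_))
  · exact Set.image_congr fun m hm => hc m hm
  · ext q
    constructor <;> rintro ⟨m, m', h1, h2, h3, h4, h5⟩ <;>
      exact ⟨m, m', h1, h2, h3, by simp [h4, hc m h1], by simp [h5, hc m' h2]⟩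
  · ext q
    constructor <;> rintro ⟨m, m', h1, h2, h3, h4, h5⟩ <;>
      exact ⟨m, m', h1, h2, h3, h4, by simp [h5, hc m' h2]⟩
  · ext q
    constructor <;> rintro ⟨m, m', h1, h2, h3, h4, h5⟩ <;>
      exact ⟨m, m', h1, h2, h3, h4, by simp [h5, hc m' h2]⟩

variable {kind Rb comp}

theorem exists_colour_eq {σ : Equiv.Perm (Option J)} {n : ℕ} {s s' : Fin n → Set M}
    (h : ∀ i, starView kind Rb comp i n s = starView kind Rb comp (σ i) n s') (m : M) :
    ∃ m', colour kind s' m' = colour kind s m := by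
  have : colour kind s m ∈ (starView kind Rb comp (comp m) n s).1 := ⟨m, rfl, rfl⟩
  rw [h] at this
  obtain ⟨m', -, h'⟩ := this
  exact ⟨m', h'⟩

theorem starView_subset {σ : Equiv.Perm (Option J)} {n : ℕ} {s s' : Fin n → Set M}
    (h : ∀ i, starView kind Rb comp i n s = starView kind Rb comp (σ i) n s') (X Y : Fin n)
    (hs : s X ⊆ s Y) : s' X ⊆ s' Y := by
  intro m hm
  have h' : ∀ i, starView kind Rb comp i n s' = starView kind Rb comp (σ.symm i) n s := by
    intro i
    rw [h (σ.symm i), Equiv.apply_symm_apply]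
  obtain ⟨m', hm'⟩ := exists_colour_eq h' m
  have e := Set.ext_iff.mp (congrArg Prod.snd hm')
  exact (e Y).mp (hs ((e X).mpr hm))

/-- A related pair lies inside one part or meets the centre. A pair inside a part reappears in the
matching part. In the other case the central member is recovered from its kind alone, and since `σ`
fixes the centre it lies in the corresponding sets of `s'`. -/
theorem starView_binary (hcross : ∀ b m m', Rb b m m' →
      comp m = comp m' ∨ comp m = none ∨ comp m' = none)
    (hkind : ∀ m m', comp m = none → comp m' = none → kind m = kind m' → m = m')
    {σ : Equiv.Perm (Option J)} (hσ : σ none = none) {n : ℕ} {s s' : Fin n → Set M}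
    (h : ∀ i, starView kind Rb comp i n s = starView kind Rb comp (σ i) n s') (b : B)
    (X Y : Fin n) (hs : ∃ m m', Rb b m m' ∧ m ∈ s X ∧ m' ∈ s Y) :
    ∃ m m', Rb b m m' ∧ m ∈ s' X ∧ m' ∈ s' Y := by
  obtain ⟨m, m', hR, hX, hY⟩ := hs
  have hcentre : ∀ m, comp m = none → ∀ j, m ∈ s j → m ∈ s' j := by
    intro m hm j hj
    have e : colour kind s m ∈ (starView kind Rb comp none n s).1 := ⟨m, hm, rfl⟩
    rw [h, hσ] at e
    obtain ⟨m', h1, h2⟩ := e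
    obtain rfl := hkind m' m h1 hm (congrArg Prod.fst h2)
    exact (Set.ext_iff.mp (congrArg Prod.snd h2) j).mpr hj
  have mem : ∀ {a a' : M}, colour kind s a = colour kind s' a' → ∀ j, a ∈ s j → a' ∈ s' j :=
    fun e j hj => (Set.ext_iff.mp (congrArg Prod.snd e) j).mp hj
  rcases hcross b m m' hR with hc | hc | hc
  · have e : (b, colour kind s m, colour kind s m') ∈ (starView kind Rb comp (comp m) n s).2.1 :=
      ⟨m, m', rfl, hc.symm, hR, rfl, rfl⟩
    rw [h] at e
    obtain ⟨a, a', -, -, h1, h2, h3⟩ := e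
    exact ⟨a, a', h1, mem h2 _ hX, mem h3 _ hY⟩
  · have e : (b, kind m, colour kind s m') ∈ (starView kind Rb comp (comp m') n s).2.2.1 :=
      ⟨m, m', hc, rfl, hR, rfl, rfl⟩
    rw [h] at e
    obtain ⟨a, a', ha, -, h1, h2, h3⟩ := e
    obtain rfl := hkind m a hc ha h2
    exact ⟨m, a', h1, hcentre m hc _ hX, mem h3 _ hY⟩
  · have e : (b, kind m', colour kind s m) ∈ (starView kind Rb comp (comp m) n s).2.2.2 :=
      ⟨m', m, hc, rfl, hR, rfl, rfl⟩
    rw [h] at e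
    obtain ⟨a, a', ha, -, h1, h2, h3⟩ := e
    obtain rfl := hkind m' a hc ha h2
    exact ⟨a', m', h1, mem h3 _ hX, hcentre m' hc _ hY⟩

end Star

/-- A structure on `M` all of whose relations are determined by the kinds of elements or by one of
the binary relations `Rb b`, together with a centre (the elements with `comp m = none`) whose
elements have distinct kinds and whose deletion separates the parts. -/
structure IsStar {L : FirstOrder.Language.{u, v}} {M : Type w} [L.Structure M] {J : Type w'}
    {κ B : Type} (kind : M → κ) (Rb : B → M → M → Prop) (comp : M → Option J) : Prop where
  cross : ∀ b m m', Rb b m m' → comp m = comp m' ∨ comp m = none ∨ comp m' = none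
  kind_inj : ∀ m m', comp m = none → comp m' = none → kind m = kind m' → m = m'
  rel : ∀ (k : ℕ) (R : L.Relations k) (n : ℕ) (Z : Fin k → Fin n),
    (∃ (p : κ → Prop) (X : Fin n), ∀ s : Fin n → Set M,
      (MSO.rel R Z).Realize s ↔ ∃ m, p (kind m) ∧ m ∈ s X) ∨
    (∃ (b : B) (X Y : Fin n), ∀ s : Fin n → Set M,
      (MSO.rel R Z).Realize s ↔ ∃ m m', Rb b m m' ∧ m ∈ s X ∧ m' ∈ s Y)

/-! ### Exchanging parts and counting elements -/

section

variable {L : FirstOrder.Language.{u, v}} {M : Type w} [L.Structure M] {J : Type w'}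
  {κ B : Type} {kind : M → κ} {Rb : B → M → M → Prop} {comp : M → Option J}

theorem IsStar.realize (h : IsStar (L := L) kind Rb comp) {n : ℕ} (φ : MSO L n)
    (σ : Equiv.Perm (Option J)) (r : ℕ) (s s' : Fin n → Set M) (hσ : σ none = none)
    (hr : φ.rank ≤ r)
    (ht : ∀ i, tp (starView kind Rb comp i) r n s = tp (starView kind Rb comp (σ i)) r n s') :
    φ.Realize s → φ.Realize s' := by
  refine realize_of_tp_eq comp (starView kind Rb comp) (starView_congr kind Rb comp)
    (fun σ n s s' hv X Y => starView_subset hv X Y) none ?_ φ σ r s s' hσ hr ht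
  intro σ hσ n s s' hv k R Z
  rcases h.rel k R n Z with ⟨p, X, hp⟩ | ⟨b, X, Y, hb⟩
  · rw [hp, hp]
    rintro ⟨m, hm, hX⟩
    obtain ⟨m', hm'⟩ := exists_colour_eq hv m
    refine ⟨m', ?_, (Set.ext_iff.mp (congrArg Prod.snd hm') X).mpr hX⟩
    have : kind m' = kind m := congrArg Prod.fst hm'
    rwa [this]
  · rw [hb, hb]
    exact starView_binary h.cross h.kind_inj hσ hv b X Y

/-- An element may be replaced by one of the same type in another part, as long as the second
element lies in neither of the two parts. -/
theorem IsStar.realize_replace (h : IsStar (L := L) kind Rb comp) (φ : MSO L 2) {r : ℕ}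
    (hr : φ.rank ≤ r) {a a' e : M} (ha : comp a ≠ none) (ha' : comp a' ≠ none)
    (hae : comp e ≠ comp a) (hae' : comp e ≠ comp a')
    (h1 : tp (starView kind Rb comp (comp a)) r 2 ![{a}, ∅] =
      tp (starView kind Rb comp (comp a')) r 2 ![{a'}, ∅])
    (h2 : tp (starView kind Rb comp (comp a)) r 2 ![∅, ∅] =
      tp (starView kind Rb comp (comp a')) r 2 ![∅, ∅])
    (hφ : φ.Realize ![{a}, {e}]) : φ.Realize ![{a'}, {e}] := by
  classical
  have key : ∀ i (x y : M) (X : Set M), comp y ≠ i → (∀ m, comp m = i → (m = x ↔ m ∈ X)) →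
      tp (starView kind Rb comp i) r 2 ![{x}, {y}] = tp (starView kind Rb comp i) r 2 ![X, ∅] := by
    intro i x y X hy hX
    refine tp_congr comp _ (starView_congr kind Rb comp) i r 2 _ _ fun j m hm => ?_
    fin_cases j
    · simpa using hX m hm
    · simp only [Fin.mk_one, Fin.isValue, Matrix.cons_val_one, Matrix.cons_val_fin_one,
        Set.mem_singleton_iff, Set.mem_empty_iff_false, iff_false]
      rintro rfl
      exact hy hm
  -- The parts of `a` and `a'` are exchanged: `h1` matches the marked part of `a` with the marked
  -- part of `a'`, and `h2` matches the two parts while unmarked. All other parts, including that of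
  -- `e`, stay fixed.
  refine h.realize φ (Equiv.swap (comp a) (comp a')) r _ _
    (Equiv.swap_apply_of_ne_of_ne ha.symm ha'.symm) hr (fun i => ?_) hφ
  by_cases hi : i = comp a
  · subst hi
    rw [Equiv.swap_apply_left, key _ a e {a} hae (by simp), h1, key _ a' e {a'} hae' (by simp)]
  by_cases hi' : i = comp a'
  · subst hi'
    rw [Equiv.swap_apply_right, key _ a e ∅ hae' (by rintro m hm; constructor
                                                     · rintro rfl; exact (hi hm.symm).elim
                                                     · simp),
      ← h2, key _ a' e ∅ hae (by rintro m hm; constructor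
                                 · rintro rfl; exact (hi hm).elim
                                 · simp)]
  · rw [Equiv.swap_apply_of_ne_of_ne hi hi']
    refine tp_congr comp _ (starView_congr kind Rb comp) i r 2 _ _ fun j m hm => ?_
    fin_cases j
    · simp only [Fin.zero_eta, Fin.isValue, Matrix.cons_val_zero, Set.mem_singleton_iff]
      constructor
      · rintro rfl; exact (hi hm.symm).elim
      · rintro rfl; exact (hi' hm.symm).elim
    · simp

/-- A definable relation that is functional from right to left links only boundedly many elements
with an element of another part. -/
theorem IsStar.ncard_le [Finite κ] [Finite B] (h : IsStar (L := L) kind Rb comp)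
    {A : Type u'} [Finite A] {E : Type v'} {ι : Type} [Finite ι] (φ : ι → MSO L 2) {r : ℕ}
    (hr : ∀ i, (φ i).rank ≤ r) (f : A → M) (hf : Function.Injective f) (g : E → M)
    (hfun : ∀ i a a' e, (φ i).Realize ![{f a}, {g e}] → (φ i).Realize ![{f a'}, {g e}] → a = a') :
    {a | comp (f a) = none ∨
      ∃ i e, (φ i).Realize ![{f a}, {g e}] ∧ comp (f a) ≠ comp (g e)}.ncard ≤
      Nat.card κ + 2 * Nat.card (ι × Ty (StarView κ B) r 2 × Ty (StarView κ B) r 2) := by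
  classical
  have := Fintype.ofFinite A
  have := Fintype.ofFinite (ι × Ty (StarView κ B) r 2 × Ty (StarView κ B) r 2)
  let S : Set A := {a | comp (f a) ≠ none ∧
    ∃ i e, (φ i).Realize ![{f a}, {g e}] ∧ comp (f a) ≠ comp (g e)}
  have h0 : {a | comp (f a) = none}.ncard ≤ Nat.card κ := by
    rw [← Set.ncard_univ]
    refine Set.ncard_le_ncard_of_injOn (fun a => kind (f a)) (fun _ _ => Set.mem_univ _) ?_
    intro a ha a' ha' haa
    exact hf (h.kind_inj _ _ ha ha' haa)
  have hS : S.ncard ≤ 2 * Nat.card (ι × Ty (StarView κ B) r 2 × Ty (StarView κ B) r 2) := by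
    have hex : ∀ a : S, ∃ i e, (φ i).Realize ![{f a}, {g e}] ∧ comp (f a) ≠ comp (g e) :=
      fun a => a.2.2
    choose i e hie hne using hex
    let Θ : S → ι × Ty (StarView κ B) r 2 × Ty (StarView κ B) r 2 := fun a =>
      (i a, tp (starView kind Rb comp (comp (f a))) r 2 ![{f a}, ∅],
        tp (starView kind Rb comp (comp (f a))) r 2 ![∅, ∅])
    -- If the witness `g (e a)` lay outside the part of `f a'`, then `a` could be replaced by `a'`
    -- for the same witness, against `hfun`.
    have hΘ : ∀ a a' : S, Θ a = Θ a' → a ≠ a' → comp (g (e a)) = comp (f a') := by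
      intro a a' haa hn
      by_contra hc
      simp only [Θ, Prod.mk.injEq] at haa
      have := h.realize_replace (φ (i a)) (hr _) a.2.1 a'.2.1 (hne a).symm hc haa.2.1 haa.2.2 (hie a)
      exact hn (Subtype.ext (hfun _ _ _ _ (hie a) this))
    rw [← Nat.card_coe_set_eq, Nat.card_eq_fintype_card, Nat.card_eq_fintype_card,
      ← Finset.card_univ, ← Finset.card_univ]
    -- Fibres of `Θ` have at most two elements. Given `a`, `b`, `c` in one fibre, the witness of `a`
    -- lies in the parts of `b` and of `c`, so these parts agree. The witness of `b` lies in the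
    -- part of `c`, hence in that of `b` itself, against `hne`.
    refine Finset.card_le_mul_card_image_of_maps_to (f := Θ) (fun _ _ => Finset.mem_univ _) 2 ?_
    intro θ _
    by_contra hlt
    rw [not_le, Finset.two_lt_card] at hlt
    obtain ⟨a, ha, b, hb, c, hc, hab, hac, hbc⟩ := hlt
    simp only [Finset.mem_filter, Finset.mem_univ, true_and] at ha hb hc
    have e1 := hΘ a b (ha.trans hb.symm) hab
    have e2 := hΘ a c (ha.trans hc.symm) hac
    have e3 := hΘ b c (hb.trans hc.symm) hbc
    exact hne b (e1.symm.trans (e2.trans e3.symm))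
  calc _ ≤ ({a | comp (f a) = none} ∪ S).ncard := by
        refine Set.ncard_le_ncard ?_ (Set.toFinite _)
        rintro a (ha | ha)
        · exact Or.inl ha
        · by_cases hn : comp (f a) = none
          · exact Or.inl hn
          · exact Or.inr ⟨hn, ha⟩
    _ ≤ _ := (Set.ncard_union_le _ _).trans (Nat.add_le_add h0 hS)

end

/-! ### The components of a tree without a vertex -/

/-- The component of `u` in a tree without the vertex `x`: `none` if `u = x`, `some none` if `u` is
not below `x`, and `some (some d)` if `u` is below the child `x ++ [d]`. -/
def treeComp (x u : List ℕ) : Option (Option ℕ) :=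
  if x <+: u then (u.drop x.length).head?.map some else some none

@[simp] theorem treeComp_append (x t : List ℕ) : treeComp x (x ++ t) = t.head?.map some := by
  simp [treeComp]

@[simp] theorem treeComp_self (x : List ℕ) : treeComp x x = none := by
  simp [treeComp]

theorem treeComp_of_not_prefix {x u : List ℕ} (h : ¬ x <+: u) : treeComp x u = some none := by
  simp [treeComp, h]

theorem treeComp_eq_none {x u : List ℕ} : treeComp x u = none ↔ u = x := by
  by_cases h : x <+: u
  · obtain ⟨t, rfl⟩ := h
    simp
  · rw [treeComp_of_not_prefix h]
    simp only [reduceCtorEq, false_iff]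
    rintro rfl
    exact h List.prefix_rfl

theorem treeComp_eq_above {x u : List ℕ} : treeComp x u = some none ↔ ¬ x <+: u := by
  refine ⟨?_, treeComp_of_not_prefix⟩
  rintro h ⟨t, rfl⟩
  cases t <;> simp at h

theorem treeComp_edge (x y : List ℕ) (d : ℕ) : treeComp x y = treeComp x (y ++ [d]) ∨
    treeComp x y = none ∨ treeComp x (y ++ [d]) = none := by
  by_cases h : x <+: y
  · obtain ⟨t, rfl⟩ := h
    cases t <;> simp [List.append_assoc]
  · rw [treeComp_eq_none, treeComp_eq_none, treeComp_of_not_prefix h]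
    by_cases h' : x <+: y ++ [d]
    · rw [List.prefix_concat_iff] at h'
      tauto
    · rw [treeComp_of_not_prefix h']
      exact Or.inl rfl

/-- The path between `u` and `w` is connected. -/
theorem TreeDom.reachable_of_treeComp_ne (T : TreeDom) (u w : T.verts) (S : Set T.verts)
    (hu : u ∈ S) (hS : ∀ x : T.verts, treeComp x.1 u.1 ≠ treeComp x.1 w.1 → x ∈ S)
    (x : T.verts) (hx : treeComp x.1 u.1 ≠ treeComp x.1 w.1) :
    (T.graph.induce S).Reachable ⟨x, hS x hx⟩ ⟨u, hu⟩ := by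
  have step : ∀ (y z : T.verts) (hy : y ∈ S) (hz : z ∈ S), (∃ d, z.1 = y.1 ++ [d]) →
      (T.graph.induce S).Adj ⟨y, hy⟩ ⟨z, hz⟩ := by
    rintro y z hy hz ⟨d, hd⟩
    simp only [SimpleGraph.comap_adj, Function.Embedding.subtype_apply, TreeDom.graph,
      SimpleGraph.fromRel_adj]
    refine ⟨?_, Or.inl ⟨d, hd⟩⟩
    rintro rfl
    simp at hd
  -- The vertices `x` with `treeComp x u ≠ treeComp x w` form the path from `u` to `w`, which is
  -- empty here if `u = w`. From a prefix of `u` one descends to `u`.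
  have below : ∀ (t : List ℕ) (x : T.verts) (hx : treeComp x.1 u.1 ≠ treeComp x.1 w.1),
      u.1 = x.1 ++ t → (T.graph.induce S).Reachable ⟨x, hS x hx⟩ ⟨u, hu⟩ := by
    intro t
    induction t with
    | nil =>
      intro x hx h
      have : x = u := Subtype.ext (by simpa using h.symm)
      subst this
      exact SimpleGraph.Reachable.refl _
    | cons d t ih =>
      intro x hx h
      have hy : x.1 ++ [d] ∈ T.verts := T.prefix_closed _ u.1 ⟨t, by simp [h]⟩ u.2
      have hy' : treeComp (x.1 ++ [d]) u.1 ≠ treeComp (x.1 ++ [d]) w.1 := by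
        rw [treeComp_of_not_prefix (u := w.1)]
        · rw [Ne, treeComp_eq_above, not_not]
          exact ⟨t, by simp [h]⟩
        · rintro ⟨t', h'⟩
          apply hx
          rw [h, ← h']
          simp [List.append_assoc]
      exact (step x ⟨_, hy⟩ (hS x hx) (hS _ hy') ⟨d, rfl⟩).reachable.trans
        (ih ⟨_, hy⟩ hy' (by simp [h]))
  obtain ⟨x, hxT⟩ := x
  -- A vertex of the path that is not a prefix of `u` is a prefix of `w`, and its parent is again on
  -- the path; so one climbs until a prefix of `u` is reached.
  induction x using List.reverseRecOn with
  | nil => exact below u.1 _ hx rfl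
  | append_singleton y d ih =>
    by_cases hp : y ++ [d] <+: u.1
    · obtain ⟨t, ht⟩ := hp
      exact below t _ hx ht.symm
    · have hy : y ∈ T.verts := T.prefix_closed _ _ ⟨[d], rfl⟩ hxT
      have hw : y ++ [d] <+: w.1 := by
        by_contra hw
        exact hx ((treeComp_of_not_prefix hp).trans (treeComp_of_not_prefix hw).symm)
      have hy' : treeComp y u.1 ≠ treeComp y w.1 := by
        obtain ⟨t, ht⟩ := hw
        rw [← ht, List.append_assoc, treeComp_append]
        intro h
        by_cases h' : y <+: u.1
        · obtain ⟨t', ht'⟩ := h'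
          rw [← ht', treeComp_append] at h
          cases t' with
          | nil => simp at h
          | cons d' t' =>
            simp only [List.head?_cons, Option.map_some, List.cons_append, Option.some.injEq] at h
            exact hp ⟨t', by rw [← ht', h]; simp⟩
        · rw [treeComp_of_not_prefix h'] at h
          simp at h
      exact (step ⟨y, hy⟩ ⟨_, hxT⟩ (hS _ hy') (hS _ hx) ⟨d, rfl⟩).symm.reachable.trans
        (ih hy hy')

/-! ### Copies of expansions of the incidence structure of a tree -/

section TreeStructure

variable (T : TreeDom)

/-- The domain of the incidence structure of a tree. -/
abbrev TreeDom.Inc : Type := T.toFinStr.incidence.carrier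

variable {T}

theorem exists_edg (e : Tuples FirstOrder.Language.graph T.toFinStr.carrier) :
    ∃ x y : T.verts, T.edg x y ∧ e.1 = ⟨2, ![x, y]⟩ := by
  obtain ⟨⟨n, c⟩, R, hR⟩ := e
  cases R
  refine ⟨c 0, c 1, hR, ?_⟩
  have : c = ![c 0, c 1] := by
    ext i
    fin_cases i <;> rfl
  exact congrArg (Sigma.mk 2) this

/-- The location of an element of the incidence structure: edges are located at their target. -/
noncomputable def loc : T.Inc → T.verts
  | .inl x => x
  | .inr e => (exists_edg e).choose_spec.choose

theorem loc_spec (e : Tuples FirstOrder.Language.graph T.toFinStr.carrier) :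
    ∃ x : T.verts, T.edg x (loc (.inr e)) ∧ e.1 = ⟨2, ![x, loc (.inr e)]⟩ :=
  ⟨_, (exists_edg e).choose_spec.choose_spec⟩

/-- Parents are unique, so an edge is determined by its target. Hence in each copy the centre at `x`
contains at most one vertex and one edge, which `treeKind` tells apart. -/
theorem loc_inr_injective {e e' : Tuples FirstOrder.Language.graph T.toFinStr.carrier}
    (h : loc (T := T) (.inr e) = loc (.inr e')) : e = e' := by
  obtain ⟨x, ⟨d, hx⟩, he⟩ := loc_spec e
  obtain ⟨x', ⟨d', hx'⟩, he'⟩ := loc_spec e'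
  have : x = x' := by
    rw [h, hx'] at hx
    exact Subtype.ext (List.append_inj_left' hx rfl).symm
  apply Subtype.ext
  rw [he, he', h, this]

variable (T) in
/-- The copies of an expansion of the incidence structure of a tree. -/
abbrev TreeDom.copies {p : ℕ} (k : ℕ) (Q : Fin p → Set T.Inc) :
    FinStr.{0, 0, 0} (copyLang (expLang (incLang FirstOrder.Language.graph) p) k) :=
  (T.toFinStr.incidence.expand Q).copy k

/-- The unary information on an element. -/
def treeKind {p k : ℕ} (Q : Fin p → Set T.Inc) (m : T.Inc × Fin k) : Bool × Set (Fin p) × Fin k :=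
  (m.1.isRight, {q | m.1 ∈ Q q}, m.2)

/-- The binary relations of the copies: equality up to copies, and the incidence relations. -/
def treeRel {k : ℕ} : Option (Fin 2) → T.Inc × Fin k → T.Inc × Fin k → Prop
  | none, m, m' => m.1 = m'.1
  | some i, m, m' => m.2 = m'.2 ∧
    FirstOrder.Language.Structure.RelMap (L := incLang FirstOrder.Language.graph)
      (M := T.Inc) (IncRel.inc i.1 ⟨2, i.2, ⟨.adj⟩⟩ : IncRel FirstOrder.Language.graph 2) ![m.1, m'.1]

theorem realize_rel_unary {L : FirstOrder.Language.{u, v}} {M : Type w} [L.Structure M]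
    {R : L.Relations 1} {P : M → Prop}
    (h : ∀ x : Fin 1 → M, FirstOrder.Language.Structure.RelMap R x ↔ P (x 0)) {n : ℕ}
    (Z : Fin 1 → Fin n) (s : Fin n → Set M) :
    (MSO.rel R Z).Realize s ↔ ∃ m, P m ∧ m ∈ s (Z 0) := by
  constructor
  · rintro ⟨a, ha, hR⟩
    exact ⟨a 0, (h a).mp hR, ha 0⟩
  · rintro ⟨m, hP, hm⟩
    refine ⟨fun _ => m, fun i => ?_, (h _).mpr hP⟩
    rwa [Subsingleton.elim i 0]

theorem realize_rel_binary {L : FirstOrder.Language.{u, v}} {M : Type w} [L.Structure M]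
    {R : L.Relations 2} {P : M → M → Prop}
    (h : ∀ x : Fin 2 → M, FirstOrder.Language.Structure.RelMap R x ↔ P (x 0) (x 1)) {n : ℕ}
    (Z : Fin 2 → Fin n) (s : Fin n → Set M) :
    (MSO.rel R Z).Realize s ↔ ∃ m m', P m m' ∧ m ∈ s (Z 0) ∧ m' ∈ s (Z 1) := by
  constructor
  · rintro ⟨a, ha, hR⟩
    exact ⟨a 0, a 1, (h a).mp hR, ha 0, ha 1⟩
  · rintro ⟨m, m', hP, hm, hm'⟩
    refine ⟨![m, m'], fun i => ?_, (h _).mpr hP⟩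
    fin_cases i
    · exact hm
    · exact hm'

theorem relMap_pred_iff (x : Fin 1 → T.Inc) :
    FirstOrder.Language.Structure.RelMap (L := incLang FirstOrder.Language.graph)
      (M := T.Inc) (IncRel.pred .adj : IncRel FirstOrder.Language.graph 1) x ↔
    (x 0).isRight = true := by
  constructor
  · rintro ⟨e, c, h, -⟩
    rw [h]
    rfl
  · intro h
    obtain ⟨e, he⟩ := Sum.isRight_iff.mp h
    obtain ⟨y, hy, h2⟩ := loc_spec e
    exact ⟨e, _, he, h2, hy⟩

theorem relMap_inc_zero_iff (x : Fin 2 → T.Inc) (h) :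
    FirstOrder.Language.Structure.RelMap (L := incLang FirstOrder.Language.graph)
      (M := T.Inc) (IncRel.inc 0 h : IncRel FirstOrder.Language.graph 2) x ↔
    ∃ (y : T.verts) (e : Tuples FirstOrder.Language.graph T.toFinStr.carrier),
      x 0 = .inl y ∧ x 1 = .inr e ∧ T.edg y (loc (.inr e)) := by
  constructor
  · rintro ⟨a, e, h, h0, h1, h2⟩
    obtain ⟨y, hy, h3⟩ := loc_spec e
    obtain ⟨⟨n, c⟩, he⟩ := e
    obtain rfl : n = 2 := congrArg Sigma.fst h3
    have hc : c = _ := eq_of_heq (Sigma.mk.inj h3).2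
    obtain rfl : a = y := h2.trans (congrFun hc 0)
    exact ⟨a, _, h0, h1, hy⟩
  · rintro ⟨y, e, h0, h1, d, hd⟩
    obtain ⟨y', ⟨d', hd'⟩, h3⟩ := loc_spec e
    obtain rfl : y = y' := Subtype.ext (List.append_inj_left' (hd.symm.trans hd') rfl)
    obtain ⟨⟨n, c⟩, he⟩ := e
    obtain rfl : n = 2 := congrArg Sigma.fst h3
    have hc : c = _ := eq_of_heq (Sigma.mk.inj h3).2
    exact ⟨y, _, (by simp : (0 : ℕ) < 2), h0, h1, (congrFun hc 0).symm⟩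

theorem relMap_inc_one_iff (x : Fin 2 → T.Inc) (h) :
    FirstOrder.Language.Structure.RelMap (L := incLang FirstOrder.Language.graph)
      (M := T.Inc) (IncRel.inc 1 h : IncRel FirstOrder.Language.graph 2) x ↔
    ∃ e : Tuples FirstOrder.Language.graph T.toFinStr.carrier,
      x 0 = .inl (loc (.inr e)) ∧ x 1 = .inr e := by
  constructor
  · rintro ⟨a, e, h, h0, h1, h2⟩
    refine ⟨e, ?_, h1⟩
    obtain ⟨y, hy, h3⟩ := loc_spec e
    obtain ⟨⟨n, c⟩, he⟩ := e
    obtain rfl : n = 2 := congrArg Sigma.fst h3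
    have hc : c = _ := eq_of_heq (Sigma.mk.inj h3).2
    rw [h0, h2]
    exact congrArg Sum.inl (congrFun hc 1)
  · rintro ⟨e, h0, h1⟩
    obtain ⟨y, hy, h3⟩ := loc_spec e
    refine ⟨_, e, ?_, h0, h1, ?_⟩
    · rw [h3]
      exact (by simp : (1 : ℕ) < 2)
    · generalize loc (T := T) (.inr e) = z at *
      obtain ⟨⟨n, c⟩, he⟩ := e
      obtain rfl : n = 2 := congrArg Sigma.fst h3
      have hc : c = _ := eq_of_heq (Sigma.mk.inj h3).2
      exact (congrFun hc 1).symm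

/-- An edge lies in the same part as its target, and in the same part as its source unless one of
its ends is `x` (`treeComp_edge`). Copies of one element share their location, so `∼` never crosses
parts. -/
theorem isStar_copies {p k : ℕ} (Q : Fin p → Set T.Inc) (x : T.verts) :
    IsStar (L := copyLang (expLang (incLang FirstOrder.Language.graph) p) k)
      (M := (T.copies k Q).carrier) (treeKind Q) treeRel
      (fun m => treeComp x.1 (loc m.1).1) where
  cross := by
    rintro (_ | i) ⟨m, c⟩ ⟨m', c'⟩ h
    · obtain rfl : m = m' := h
      exact Or.inl rfl
    · obtain ⟨-, h⟩ := h
      fin_cases i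
      · obtain ⟨y, e, h0, h1, d, hd⟩ := (relMap_inc_zero_iff _ _).mp h
        obtain rfl : m = .inl y := h0
        obtain rfl : m' = .inr e := h1
        change treeComp x.1 y.1 = _ ∨ treeComp x.1 y.1 = _ ∨ _
        rw [hd]
        exact treeComp_edge x.1 y.1 d
      · obtain ⟨e, h0, h1⟩ := (relMap_inc_one_iff _ _).mp h
        obtain rfl : m = .inl _ := h0
        obtain rfl : m' = .inr e := h1
        exact Or.inl rfl
  kind_inj := by
    rintro ⟨m, c⟩ ⟨m', c'⟩ h h' hk
    simp only [treeComp_eq_none] at h h'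
    obtain ⟨h1, -, h3⟩ : m.isRight = m'.isRight ∧ _ = _ ∧ c = c' := by
      simpa [treeKind] using hk
    subst h3
    have hl : loc m = loc m' := Subtype.ext (h.trans h'.symm)
    rcases m with m | m <;> rcases m' with m' | m'
    · exact congrArg (fun y : T.verts => ((Sum.inl y : T.Inc), c)) hl
    · cases h1
    · cases h1
    · rw [loc_inr_injective hl]
  rel := by
    intro j R n Z
    cases R with
    | base R =>
      cases R with
      | base R =>
        cases R with
        | pred R =>
          cases R
          refine Or.inl ⟨fun q => q.1 = true, Z 0, fun s => realize_rel_unary (fun x => ?_) Z s⟩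
          exact (and_iff_right ⟨(x 0).2, fun j => by rw [Subsingleton.elim j 0]⟩).trans
            (relMap_pred_iff fun j => (x j).1)
        | inc i hi =>
          have hi2 : i < 2 := by
            obtain ⟨n, hn, ⟨R⟩⟩ := hi
            cases R
            exact hn
          refine Or.inr ⟨some ⟨i, hi2⟩, Z 0, Z 1, fun s =>
            realize_rel_binary (fun x => ?_) Z s⟩
          refine and_congr ⟨?_, ?_⟩ ?_
          · rintro ⟨c, hc⟩
            exact (hc 0).trans (hc 1).symm
          · intro h
            refine ⟨(x 0).2, fun j => ?_⟩
            fin_cases j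
            · rfl
            · exact h.symm
          · have : (fun j => (x j).1) = ![(x 0).1, (x 1).1] := by
              ext j
              fin_cases j <;> rfl
            exact iff_of_eq (congrArg _ this)
      | param q =>
        refine Or.inl ⟨fun z => q ∈ z.2.1, Z 0, fun s => realize_rel_unary (fun x => ?_) Z s⟩
        exact (and_iff_right ⟨(x 0).2, fun j => by rw [Subsingleton.elim j 0]⟩).trans Iff.rfl
    | sim hk =>
      exact Or.inr ⟨none, Z 0, Z 1, fun s => realize_rel_binary (fun x => Iff.rfl) Z s⟩
    | part hk i =>
      exact Or.inl ⟨fun q => q.2.2 = i, Z 0, fun s => realize_rel_unary (fun x => Iff.rfl) Z s⟩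

end TreeStructure

/-! ### From transductions to decompositions -/

instance finite_incIndex (L : FirstOrder.Language.{u, v}) [Finite (Σ n, L.Relations n)] :
    Finite {i : ℕ // ∃ n, i < n ∧ Nonempty (L.Relations n)} := by
  obtain ⟨N, hN⟩ := (Set.finite_range (fun R : Σ n, L.Relations n => R.1)).bddAbove
  refine Set.Finite.to_subtype ((Set.finite_lt_nat N).subset ?_)
  rintro i ⟨n, hi, ⟨R⟩⟩
  exact lt_of_lt_of_le hi (hN ⟨⟨n, R⟩, rfl⟩)

theorem relMap_inc_iff {L : FirstOrder.Language.{u, v}} {A : Type w} [L.Structure A] {i : ℕ} (hi)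
    (a : A) (e : Tuples L A) :
    FirstOrder.Language.Structure.RelMap (L := incLang L) (M := A ⊕ Tuples L A)
      (IncRel.inc i hi : IncRel L 2) ![.inl a, .inr e] ↔ ∃ h : i < e.1.1, a = e.1.2 ⟨i, h⟩ := by
  constructor
  · rintro ⟨a', e', h, h0, h1, h2⟩
    obtain rfl : a = a' := Sum.inl_injective h0
    obtain rfl : e = e' := Sum.inr_injective h1
    exact ⟨h, h2⟩
  · rintro ⟨h, h'⟩
    exact ⟨a, e, h, rfl, rfl, h'⟩

theorem exists_treeDecomp_of_belowIn (L : FirstOrder.Language.{u, v})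
    [Finite (Σ n, L.Relations n)] (C : Set (FinStr.{u, v, w} L)) (𝒯 : Set TreeDom)
    (h : BelowIn C (TreeDom.toFinStr '' 𝒯)) :
    ∃ K : ℕ, ∀ A ∈ C, ∃ T ∈ 𝒯, ∃ D : TreeDecomp T A, ∀ t, (D.bag t).ncard ≤ K := by
  obtain ⟨τ, hτ⟩ := h
  let φ : {i : ℕ // ∃ n, i < n ∧ Nonempty (L.Relations n)} →
      MSO (copyLang (expLang (incLang FirstOrder.Language.graph) τ.params) τ.copies) 2 :=
    fun i => τ.basic.phi (IncRel.inc i.1 i.2 : IncRel L 2)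
  obtain ⟨r, hr⟩ := (Set.finite_range (fun i => (φ i).rank)).bddAbove
  have hr' : ∀ i, (φ i).rank ≤ r := fun i => hr ⟨i, rfl⟩
  -- The bound from `IsStar.ncard_le` depends only on `τ` and `L`, not on `A` or its tree.
  refine ⟨Nat.card (Bool × Set (Fin τ.params) × Fin τ.copies) +
    2 * Nat.card ({i : ℕ // ∃ n, i < n ∧ Nonempty (L.Relations n)} ×
      Ty (StarView (Bool × Set (Fin τ.params) × Fin τ.copies) (Option (Fin 2))) r 2 ×
      Ty (StarView (Bool × Set (Fin τ.params) × Fin τ.copies) (Option (Fin 2))) r 2),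
    fun A hA => ?_⟩
  obtain ⟨-, ⟨X, rfl⟩, -, ⟨⟨-, ⟨T, hT, rfl⟩, rfl⟩, rfl⟩, Q, -, ⟨iso⟩⟩ := hτ ⟨A, hA, rfl⟩
  let f : A.carrier → (T.copies τ.copies Q).carrier := fun a => (iso.symm (.inl a)).1
  let g : Tuples L A.carrier → (T.copies τ.copies Q).carrier := fun e => (iso.symm (.inr e)).1
  have hf : Function.Injective f := fun a a' haa =>
    Sum.inl_injective (iso.symm.injective (Subtype.ext haa))
  have key : ∀ i a e, (φ i).Realize ![{f a}, {g e}] ↔ ∃ h : i.1 < e.1.1, a = e.1.2 ⟨i, h⟩ := by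
    intro i a e
    refine Iff.trans (Iff.trans (iff_of_eq (congrArg (φ i).Realize ?_))
      (iso.symm.map_rel (IncRel.inc i.1 i.2 : IncRel L 2) ![.inl a, .inr e]))
      (relMap_inc_iff i.2 a e)
    ext j
    fin_cases j <;> rfl
  have hfun : ∀ i a a' e, (φ i).Realize ![{f a}, {g e}] → (φ i).Realize ![{f a'}, {g e}] →
      a = a' := by
    intro i a a' e h1 h2
    obtain ⟨_, h1⟩ := (key i a e).mp h1
    obtain ⟨_, h2⟩ := (key i a' e).mp h2
    exact h1.trans h2.symm
  let lc : (T.copies τ.copies Q).carrier → T.verts := fun m => loc m.1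
  -- The second alternative says that `x` is on the path from `a` to a tuple containing `a`. The
  -- first covers elements that occur in no tuple or only in tuples at their own location.
  let bag : T.verts → Set A.carrier := fun x => {a | treeComp x.1 (lc (f a)).1 = none ∨
    ∃ i e, (φ i).Realize ![{f a}, {g e}] ∧ treeComp x.1 (lc (f a)).1 ≠ treeComp x.1 (lc (g e)).1}
  refine ⟨T, hT, ⟨bag, fun a => ?_, fun {n} R c hc => ?_⟩, fun x =>
    (isStar_copies Q x).ncard_le φ hr' f hf g hfun⟩
  · have hu : lc (f a) ∈ {t | a ∈ bag t} := Or.inl (treeComp_self _)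
    rw [SimpleGraph.connected_iff_exists_forall_reachable]
    refine ⟨⟨lc (f a), hu⟩, ?_⟩
    rintro ⟨x, hx | ⟨i, e, hie, hne⟩⟩
    · obtain rfl : lc (f a) = x := Subtype.ext (treeComp_eq_none.mp hx)
      exact SimpleGraph.Reachable.refl _
    · exact (T.reachable_of_treeComp_ne (lc (f a)) (lc (g e)) _ hu
        (fun y hy => Or.inr ⟨i, e, hie, hy⟩) x hne).symm
  · let e : Tuples L A.carrier := ⟨⟨n, c⟩, R, hc⟩
    -- The location of the tuple ends all paths from its components, so its bag contains every
    -- component.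
    refine ⟨lc (g e), fun j => ?_⟩
    by_cases hj : treeComp (lc (g e)).1 (lc (f (c j))).1 = none
    · exact Or.inl hj
    · refine Or.inr ⟨⟨j, n, j.2, ⟨R⟩⟩, e, (key _ _ _).mpr ⟨j.2, rfl⟩, ?_⟩
      rwa [treeComp_self]

/-! ### Colourings of decompositions -/

/-- A connected set of vertices of a tree has a topmost vertex, and contains all vertices between
this vertex and any other member. -/
theorem TreeDom.exists_top (T : TreeDom) (S : Set T.verts) (h : (T.graph.induce S).Connected) :
    ∃ x ∈ S, ∀ v ∈ S, x.1 <+: v.1 ∧ ∀ w : T.verts, x.1 <+: w.1 → w.1 <+: v.1 → w ∈ S := by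
  obtain ⟨⟨x₀, hx₀⟩⟩ := h.nonempty
  obtain ⟨x, hx, hmin⟩ := Set.exists_min_image S (fun v => v.1.length) (Set.toFinite _) ⟨x₀, hx₀⟩
  refine ⟨x, hx, fun v hv => ?_⟩
  have hr := (SimpleGraph.reachable_iff_reflTransGen _ _).mp (h.preconnected ⟨x, hx⟩ ⟨v, hv⟩)
  suffices ∀ y : S, Relation.ReflTransGen (T.graph.induce S).Adj ⟨x, hx⟩ y →
      x.1 <+: y.1.1 ∧ ∀ w : T.verts, x.1 <+: w.1 → w.1 <+: y.1.1 → w ∈ S from this _ hr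
  intro y hy
  induction hy with
  | refl =>
    refine ⟨List.prefix_rfl, fun w h1 h2 => ?_⟩
    rwa [Subtype.ext (List.IsPrefix.eq_of_length_le h2 h1.length_le)]
  | @tail y z _ hyz ih =>
    obtain ⟨h1, h2⟩ := ih
    simp only [SimpleGraph.comap_adj, Function.Embedding.subtype_apply, TreeDom.graph,
      SimpleGraph.fromRel_adj] at hyz
    rcases hyz with ⟨-, ⟨d, hd⟩ | ⟨d, hd⟩⟩
    · rw [hd]
      refine ⟨h1.trans (List.prefix_append _ _), fun w h3 h4 => ?_⟩
      rcases List.prefix_concat_iff.mp h4 with h4 | h4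
      · rw [Subtype.ext (h4.trans hd.symm)]
        exact z.2
      · exact h2 w h3 h4
    · have hz : z.1.1 <+: y.1.1 := by
        rw [hd]
        exact List.prefix_append _ _
      -- A step towards the root stays below `x`, because `x` has minimal length in `S`.
      exact ⟨List.prefix_of_prefix_length_le h1 hz (hmin z.1 z.2),
        fun w h3 h4 => h2 w h3 (h4.trans hz)⟩

/-- The elements of a decomposed structure can be coloured injectively on every bag. -/
theorem TreeDecomp.exists_colouring {L : FirstOrder.Language.{u, v}} {T : TreeDom}
    {A : FinStr.{u, v, w} L} (D : TreeDecomp T A) {K : ℕ} (hK : ∀ t, (D.bag t).ncard ≤ K) :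
    ∃ col : A.carrier → Fin K, ∀ t, ∀ a ∈ D.bag t, ∀ b ∈ D.bag t, col a = col b → a = b := by
  classical
  have := Fintype.ofFinite A.carrier
  choose top htop hbelow using fun a => T.exists_top _ (D.connected a)
  have hpos : ∀ a : A.carrier, 0 < K := fun a =>
    ((Set.ncard_pos (Set.toFinite _)).mpr ⟨a, htop a⟩).trans_le (hK (top a))
  suffices ∀ s : Finset A.carrier, ∃ col : A.carrier → Fin K, ∀ a ∈ s, ∀ b ∈ s, ∀ t,
      a ∈ D.bag t → b ∈ D.bag t → col a = col b → a = b by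
    obtain ⟨col, h⟩ := this Finset.univ
    exact ⟨col, fun t a ha b hb => h a (Finset.mem_univ _) b (Finset.mem_univ _) t ha hb⟩
  intro s
  -- Greedy colouring by depth of the topmost vertex. An earlier element that shares a bag with `a`
  -- also lies in the bag of `top a`, which has at most `K - 1` elements besides `a`, so some colour
  -- is free.
  induction s using Finset.induction_on_max_value (fun a => (top a).1.length) with
  | empty => exact ⟨fun a => ⟨0, hpos a⟩, by simp⟩
  | insert a s has hmax ih =>
    obtain ⟨col, hcol⟩ := ih
    obtain ⟨c, hc⟩ : ∃ c, c ∉ col '' (D.bag (top a) \ {a}) := by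
      by_contra! hall
      have h1 : (Set.univ : Set (Fin K)).ncard ≤ (D.bag (top a) \ {a}).ncard :=
        (Set.ncard_le_ncard fun c _ => hall c).trans (Set.ncard_image_le (Set.toFinite _))
      have h2 := Set.ncard_sdiff_singleton_lt_of_mem (show a ∈ D.bag (top a) from htop a) (Set.toFinite _)
      have h3 := hK (top a)
      rw [Set.ncard_univ, Nat.card_eq_fintype_card, Fintype.card_fin] at h1
      omega
    have new : ∀ b ∈ s, ∀ t, a ∈ D.bag t → b ∈ D.bag t → col b ≠ c := by
      rintro b hb t hat hbt rfl
      refine hc ⟨b, ⟨?_, ?_⟩, rfl⟩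
      · have h1 := (hbelow a t hat).1
        have h2 := hbelow b t hbt
        exact h2.2 (top a) (List.prefix_of_prefix_length_le h2.1 h1 (hmax b hb)) h1
      · rintro rfl
        exact has hb
    refine ⟨Function.update col a c, ?_⟩
    intro b hb b' hb' t hbt hbt' e
    rw [Finset.mem_insert] at hb hb'
    have ne : ∀ b ∈ s, b ≠ a := fun b hb h => has (h ▸ hb)
    rcases hb with rfl | hb <;> rcases hb' with rfl | hb'
    · rfl
    · rw [Function.update_self, Function.update_of_ne (ne _ hb')] at e
      exact (new b' hb' t hbt hbt' e.symm).elim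
    · rw [Function.update_self, Function.update_of_ne (ne _ hb)] at e
      exact (new b hb t hbt' hbt e).elim
    · rw [Function.update_of_ne (ne _ hb), Function.update_of_ne (ne _ hb')] at e
      exact hcol b hb b' hb' t hbt hbt' e

/-! ### Formulae -/

namespace MSO

variable {L : FirstOrder.Language.{u, v}} {n : ℕ}

/-- Negation. -/
def neg (φ : MSO L n) : MSO L n := .imp φ .falsum

/-- Conjunction. -/
def conj (φ ψ : MSO L n) : MSO L n := neg (.imp φ (neg ψ))

/-- The disjunction of a list of formulae. -/
def disj : List (MSO L n) → MSO L n
  | [] => falsum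
  | φ :: l => imp φ.neg (disj l)

/-- The disjunction of finitely many formulae. -/
noncomputable def any {ι : Type w} [Finite ι] (φ : ι → MSO L n) : MSO L n :=
  disj ((Set.toFinite (Set.univ : Set ι)).toFinset.toList.map φ)

variable {A : Type w'} [L.Structure A] (s : Fin n → Set A)

theorem realize_imp (φ ψ : MSO L n) : (φ.imp ψ).Realize s ↔ (φ.Realize s → ψ.Realize s) := Iff.rfl

theorem realize_subset (X Y : Fin n) : (subset (L := L) X Y).Realize s ↔ s X ⊆ s Y := Iff.rfl

theorem realize_all (φ : MSO L (n + 1)) : φ.all.Realize s ↔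
    ∀ X : Set A, φ.Realize (Fin.snoc (α := fun _ : Fin (n + 1) => Set A) s X) := Iff.rfl

theorem realize_neg (φ : MSO L n) : φ.neg.Realize s ↔ ¬ φ.Realize s := Iff.rfl

theorem realize_conj (φ ψ : MSO L n) : (φ.conj ψ).Realize s ↔ φ.Realize s ∧ ψ.Realize s := by
  simp [conj, neg, Realize]

theorem realize_disj (l : List (MSO L n)) : (disj l).Realize s ↔ ∃ φ ∈ l, φ.Realize s := by
  induction l with
  | nil => simp [disj, Realize]
  | cons φ l ih =>
    simp only [disj, Realize, ih, realize_neg, List.mem_cons, exists_eq_or_imp]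
    tauto

theorem realize_any {ι : Type w} [Finite ι] (φ : ι → MSO L n) :
    (any φ).Realize s ↔ ∃ i, (φ i).Realize s := by
  simp [any, realize_disj]

end MSO

/-! ### The connectivity formula -/

section Formulae

variable (K k : ℕ)

/-- The signature of `k` copies of a tree expanded by `k` predicates that describe the domain and
`K` predicates on the edges. -/
abbrev decompLang : FirstOrder.Language.{0, 0} :=
  copyLang (expLang (incLang FirstOrder.Language.graph) (k + K)) k

variable {K k}

/-- The `q`-th parameter. -/
def paramRel (q : Fin (k + K)) : (decompLang K k).Relations 1 :=
  (CopyRel.base (ExpRel.param q : ExpRel _ (k + K) 1) :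
    CopyRel (expLang (incLang FirstOrder.Language.graph) (k + K)) k 1)

/-- The `j`-th incidence relation. -/
def incRel (j : Fin 2) : (decompLang K k).Relations 2 :=
  (CopyRel.base (ExpRel.base (IncRel.inc j.1 ⟨2, j.2, ⟨.adj⟩⟩ : IncRel FirstOrder.Language.graph 2) :
      ExpRel (incLang FirstOrder.Language.graph) (k + K) 2) :
    CopyRel (expLang (incLang FirstOrder.Language.graph) (k + K)) k 2)

/-- The relation between copies of the same element. -/
def simRel (hk : 2 ≤ k) : (decompLang K k).Relations 2 :=
  (CopyRel.sim hk : CopyRel (expLang (incLang FirstOrder.Language.graph) (k + K)) k 2)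

/-- The `c`-th copy. -/
def partRel (hk : 2 ≤ k) (c : Fin k) : (decompLang K k).Relations 1 :=
  (CopyRel.part hk c : CopyRel (expLang (incLang FirstOrder.Language.graph) (k + K)) k 1)

variable {T : TreeDom} (Q : Fin (k + K) → Set T.Inc) {n : ℕ}
  (s : Fin n → Set (T.copies k Q).carrier)

theorem realize_param (q : Fin (k + K)) (Z : Fin 1 → Fin n) :
    (MSO.rel (paramRel q) Z).Realize s ↔ ∃ m, m.1 ∈ Q q ∧ m ∈ s (Z 0) :=
  realize_rel_unary (fun x => (and_iff_right ⟨(x 0).2, fun j => by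
    rw [Subsingleton.elim j 0]⟩).trans Iff.rfl) Z s

theorem realize_part (hk : 2 ≤ k) (c : Fin k) (Z : Fin 1 → Fin n) :
    (MSO.rel (partRel (K := K) hk c) Z).Realize s ↔ ∃ m, m.2 = c ∧ m ∈ s (Z 0) :=
  realize_rel_unary (fun _ => Iff.rfl) Z s

theorem realize_sim (hk : 2 ≤ k) (Z : Fin 2 → Fin n) :
    (MSO.rel (simRel (K := K) hk) Z).Realize s ↔
      ∃ m m', m.1 = m'.1 ∧ m ∈ s (Z 0) ∧ m' ∈ s (Z 1) :=
  realize_rel_binary (P := fun m m' => m.1 = m'.1) (fun _ => Iff.rfl) Z s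

theorem realize_inc (j : Fin 2) (Z : Fin 2 → Fin n) :
    (MSO.rel (incRel (K := K) (k := k) j) Z).Realize s ↔
      ∃ m m', treeRel (some j) m m' ∧ m ∈ s (Z 0) ∧ m' ∈ s (Z 1) := by
  refine realize_rel_binary (L := decompLang K k) (M := (T.copies k Q).carrier)
    (P := treeRel (some j)) (fun x => and_congr ⟨?_, ?_⟩ ?_) Z s
  · rintro ⟨c, hc⟩
    exact (hc 0).trans (hc 1).symm
  · intro h
    refine ⟨(x 0).2, fun j => ?_⟩
    fin_cases j
    · rfl
    · exact h.symm
  · have : (fun j => (x j).1) = ![(x 0).1, (x 1).1] := by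
      ext j
      fin_cases j <;> rfl
    exact iff_of_eq (congrArg _ this)

/-- The formula that expresses that the sets `0` and `1` cannot be separated, where edges outside
the parameter `q` connect. -/
def reachFormula (hk : 2 ≤ k) (q : Fin (k + K)) : MSO (decompLang K k) 2 :=
  .all <| .all <|
    -- Variables 2 and 3 are the two sides `X` and `Y` of a cut; this clause says that they cover
    -- the domain.
    .imp (.all <| .imp (.subset 2 4) <| .imp (.subset 3 4) <| .all <| .subset 5 4) <|
    .imp (MSO.neg <| .rel (simRel hk) ![2, 3]) <|
    -- Atoms are existential over the sets, so "no edge in `Y` outside the parameter has an end in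
    -- `X`" is stated for all subsets of `Y` that avoid the parameter. The later clauses forbid
    -- edges in `X` with an end in `Y`.
    .imp (.all <| .imp (.subset 4 3) <| .imp (MSO.neg <| .rel (paramRel q) ![4]) <|
      MSO.conj (MSO.neg <| .rel (incRel 0) ![2, 4]) (MSO.neg <| .rel (incRel 1) ![2, 4])) <|
    .imp (MSO.neg <| .rel (incRel 0) ![3, 2]) <|
    .imp (MSO.neg <| .rel (incRel 1) ![3, 2]) <|
    .imp (.subset 1 2) <| MSO.neg <| .subset 0 3

theorem realize_reachFormula (hk : 2 ≤ k) (q : Fin (k + K)) (a e : (T.copies k Q).carrier) :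
    (reachFormula hk q).Realize ![{a}, {e}] ↔
      ∀ X Y : Set (T.copies k Q).carrier, (∀ m, m ∈ X ∨ m ∈ Y) →
        (∀ m ∈ X, ∀ m' ∈ Y, m.1 ≠ m'.1) →
        (∀ m ∈ X, ∀ m' ∈ Y, m'.1 ∉ Q q → ∀ j, ¬ treeRel (some j) m m') →
        (∀ m ∈ Y, ∀ m' ∈ X, ∀ j, ¬ treeRel (some j) m m') → e ∈ X → a ∉ Y := by
  unfold reachFormula
  simp only [MSO.realize_imp, MSO.realize_subset, MSO.realize_all, MSO.realize_neg,
    MSO.realize_conj, realize_sim, realize_param, realize_inc]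
  change (∀ X Y : Set (T.copies k Q).carrier,
    (∀ Z : Set (T.copies k Q).carrier, X ⊆ Z → Y ⊆ Z → ∀ W : Set (T.copies k Q).carrier, W ⊆ Z) →
    (¬ ∃ m m' : (T.copies k Q).carrier, m.1 = m'.1 ∧ m ∈ X ∧ m' ∈ Y) →
    (∀ Z : Set (T.copies k Q).carrier, Z ⊆ Y →
      (¬ ∃ m : (T.copies k Q).carrier, m.1 ∈ Q q ∧ m ∈ Z) →
      (¬ ∃ m m' : (T.copies k Q).carrier, treeRel (some 0) m m' ∧ m ∈ X ∧ m' ∈ Z) ∧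
      ¬ ∃ m m' : (T.copies k Q).carrier, treeRel (some 1) m m' ∧ m ∈ X ∧ m' ∈ Z) →
    (¬ ∃ m m' : (T.copies k Q).carrier, treeRel (some 0) m m' ∧ m ∈ Y ∧ m' ∈ X) →
    (¬ ∃ m m' : (T.copies k Q).carrier, treeRel (some 1) m m' ∧ m ∈ Y ∧ m' ∈ X) →
    {e} ⊆ X → ¬ {a} ⊆ Y) ↔ _
  simp only [Set.singleton_subset_iff]
  refine forall₂_congr fun X Y => ⟨fun h h1 h2 h3 h4 => ?_, fun h h1 h2 h3 h4 h5 => ?_⟩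
  · refine h (fun Z hX hY W m _ => (h1 m).elim (@hX m) (@hY m)) ?_ ?_ ?_ ?_
    · rintro ⟨m, m', h5, hm, hm'⟩
      exact h2 m hm m' hm' h5
    · refine fun Z hZ hq => ⟨?_, ?_⟩ <;> rintro ⟨m, m', h5, hm, hm'⟩ <;>
        exact h3 m hm m' (hZ hm') (fun h' => hq ⟨m', h', hm'⟩) _ h5
    · rintro ⟨m, m', h5, hm, hm'⟩
      exact h4 m hm m' hm' _ h5
    · rintro ⟨m, m', h5, hm, hm'⟩
      exact h4 m hm m' hm' _ h5
  · refine h (fun m => h1 (X ∪ Y) Set.subset_union_left Set.subset_union_right Set.univ trivial)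
      (fun m hm m' hm' h6 => h2 ⟨m, m', h6, hm, hm'⟩) ?_ ?_
    · intro m hm m' hm' hq j hj
      have h6 := h3 {m'} (Set.singleton_subset_iff.mpr hm') (by
        rintro ⟨m'', h7, rfl⟩
        exact hq h7)
      fin_cases j
      · exact h6.1 ⟨m, m', hj, hm, rfl⟩
      · exact h6.2 ⟨m, m', hj, hm, rfl⟩
    · intro m hm m' hm' j hj
      fin_cases j
      · exact h4 ⟨m, m', hj, hm, hm'⟩
      · exact h5 ⟨m, m', hj, hm, hm'⟩

end Formulae

/-! ### From decompositions to transductions -/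

section Reach

variable {T : TreeDom}

theorem treeRel_some {k : ℕ} {j : Fin 2} {m m' : T.Inc × Fin k} (h : treeRel (some j) m m') :
    ∃ (y : T.verts) (e : Tuples FirstOrder.Language.graph T.toFinStr.carrier),
      m.1 = .inl y ∧ m'.1 = .inr e ∧ (T.edg y (loc (.inr e)) ∨ y = loc (.inr e)) := by
  obtain ⟨-, h⟩ := h
  fin_cases j
  · obtain ⟨y, e, h0, h1, h2⟩ := (relMap_inc_zero_iff _ _).mp h
    exact ⟨y, e, h0, h1, Or.inl h2⟩
  · obtain ⟨e, h0, h1⟩ := (relMap_inc_one_iff _ _).mp h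
    exact ⟨_, e, h0, h1, Or.inr rfl⟩

theorem exists_tuple_of_edg {x y : T.verts} (h : T.edg x y) :
    ∃ e : Tuples FirstOrder.Language.graph T.toFinStr.carrier, loc (T := T) (.inr e) = y ∧
      ∀ (k : ℕ) (c : Fin k), treeRel (T := T) (some 0) (.inl x, c) (.inr e, c) ∧
        treeRel (T := T) (some 1) (.inl y, c) (.inr e, c) := by
  let e : Tuples FirstOrder.Language.graph T.toFinStr.carrier := ⟨⟨2, ![x, y]⟩, .adj, h⟩
  have he : loc (T := T) (.inr e) = y := by
    obtain ⟨x', -, h'⟩ := loc_spec e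
    have : ![x, y] = ![x', loc (.inr e)] := eq_of_heq (Sigma.mk.inj h').2
    exact (congrFun this 1).symm
  refine ⟨e, he, fun k c => ⟨⟨rfl, ?_⟩, ⟨rfl, ?_⟩⟩⟩
  · exact (relMap_inc_zero_iff _ _).mpr ⟨x, e, rfl, rfl, by rwa [he]⟩
  · exact (relMap_inc_one_iff _ _).mpr ⟨e, congrArg Sum.inl he.symm, rfl⟩

variable {L : FirstOrder.Language.{u, v}} {A : FinStr.{u, v, w} L} (D : TreeDecomp T A)

/-- The vertices whose bag contains `b` and the edges between such vertices. -/
def TreeDecomp.region (b : A.carrier) : Set T.Inc :=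
  {z | b ∈ D.bag (loc z) ∧ ∀ e, z = .inr e → ∃ x, T.edg x (loc z) ∧ b ∈ D.bag x}

variable {D}

theorem TreeDecomp.mem_bag_of_treeRel {k : ℕ} {j : Fin 2} {m m' : T.Inc × Fin k}
    (h : treeRel (some j) m m') {b : A.carrier} (hb : m'.1 ∈ D.region b) : m.1 ∈ D.region b := by
  obtain ⟨y, e, h0, h1, h2⟩ := treeRel_some h
  rw [h1] at hb
  rw [h0]
  refine ⟨?_, fun _ h => by cases h⟩
  obtain ⟨hb1, hb2⟩ := hb
  change b ∈ D.bag y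
  rcases h2 with h2 | rfl
  · obtain ⟨x, ⟨d, hd⟩, hx⟩ := hb2 e rfl
    obtain ⟨d', hd'⟩ := h2
    obtain rfl : x = y := Subtype.ext (List.append_inj_left' (hd.symm.trans hd') rfl)
    exact hx
  · exact hb1

/-- If `a ≠ b`, the region of `b` is a separating side: an edge that leaves it and avoids the
parameter would lie in the region of some `b'` of the same colour, yet `b` and `b'` would share the
bag of an end, forcing `b' = b`. If `a = b`, the vertices carrying `a` are connected by edges
outside the parameter, so no cut separates `t'` from `t`. -/
theorem TreeDecomp.realize_reachFormula {K k : ℕ} (hk : 2 ≤ k) (Q : Fin (k + K) → Set T.Inc)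
    (q : Fin (k + K)) (col : A.carrier → Fin K)
    (hcol : ∀ t, ∀ a ∈ D.bag t, ∀ b ∈ D.bag t, col a = col b → a = b)
    {a b : A.carrier} (hab : col a = col b) (hq : Q q = {z | ¬ ∃ b', col b' = col b ∧ z ∈ D.region b'})
    {t t' : T.verts} (ht : a ∈ D.bag t) (ht' : b ∈ D.bag t')
    (c c' : Fin k) :
    (reachFormula hk q).Realize (A := (T.copies k Q).carrier) ![{(.inl t, c)}, {(.inl t', c')}] ↔
      a = b := by
  have mem_inl : ∀ {x : T.verts} {b : A.carrier}, (.inl x : T.Inc) ∈ D.region b ↔ b ∈ D.bag x :=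
    ⟨fun h => h.1, fun h => ⟨h, fun _ h => by cases h⟩⟩
  refine (TransductionHierarchy.realize_reachFormula Q hk q _ _).trans ⟨fun h => ?_, ?_⟩
  · by_contra hne
    refine h {m | m.1 ∈ D.region b} {m | m.1 ∉ D.region b} (fun m => em _) ?_ ?_ ?_
      (mem_inl.mpr ht') (fun h' => hne (hcol t a ht b (mem_inl.mp h') hab))
    · rintro m hm m' hm' h'
      rw [Set.mem_ofPred_eq, ← h'] at hm'
      exact hm' hm
    · rintro m hm m' hm' hnq j hj
      rw [hq] at hnq
      obtain ⟨b', hb', hreg⟩ :=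
        not_not.mp (show ¬ ¬ ∃ b', col b' = col b ∧ m'.1 ∈ D.region b' from hnq)
      obtain rfl : b' = b :=
        hcol _ b' (TreeDecomp.mem_bag_of_treeRel hj hreg).1 b (show _ ∈ D.region b from hm).1 hb'
      exact hm' hreg
    · intro m hm m' hm' j hj
      exact hm (TreeDecomp.mem_bag_of_treeRel hj hm')
  · rintro rfl X Y hXY hsim hout hin hX hY
    have hstep : ∀ y : T.verts, ∀ c c' : Fin k, ((.inl y, c) : T.Inc × Fin k) ∈ X →
        ((.inl y, c') : T.Inc × Fin k) ∈ X := by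
      intro y c c' hy
      refine (hXY _).resolve_right fun h => hsim _ hy _ h rfl
    have hedge : ∀ x y : T.verts, T.edg x y → a ∈ D.bag x → a ∈ D.bag y →
        (((.inl x, c) : T.Inc × Fin k) ∈ X ↔ ((.inl y, c) : T.Inc × Fin k) ∈ X) := by
      intro x y hxy hx hy
      obtain ⟨e, he, hrel⟩ := exists_tuple_of_edg hxy
      obtain ⟨h0, h1⟩ := hrel k c
      have hnq : (.inr e : T.Inc) ∉ Q q := by
        rw [hq]
        refine fun h => h ⟨a, rfl, ?_, fun _ _ => ⟨x, ?_, hx⟩⟩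
        · rwa [he]
        · rwa [he]
      constructor <;> intro hm
      · have h2 := (hXY (.inr e, c)).resolve_right fun h => hout _ hm _ h hnq _ h0
        exact (hXY (.inl y, c)).resolve_right fun h => hin _ h _ h2 _ h1
      · have h2 := (hXY (.inr e, c)).resolve_right fun h => hout _ hm _ h hnq _ h1
        exact (hXY (.inl x, c)).resolve_right fun h => hin _ h _ h2 _ h0
    have hr := (SimpleGraph.reachable_iff_reflTransGen _ _).mp
      ((D.connected a).preconnected ⟨t', ht'⟩ ⟨t, ht⟩)
    suffices ∀ y : {t // a ∈ D.bag t}, Relation.ReflTransGen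
        (T.graph.induce {t | a ∈ D.bag t}).Adj ⟨t', ht'⟩ y →
        ((.inl y.1, c) : T.Inc × Fin k) ∈ X from hsim _ (this _ hr) _ hY rfl
    intro y hy
    induction hy with
    | refl => exact hstep _ _ _ hX
    | @tail y z _ hyz ih =>
      simp only [SimpleGraph.comap_adj, Function.Embedding.subtype_apply, TreeDom.graph,
        SimpleGraph.fromRel_adj] at hyz
      rcases hyz with ⟨-, h | h⟩
      · exact (hedge _ _ h y.2 z.2).mp ih
      · exact (hedge _ _ h z.2 y.2).mpr ih

end Reach

/-! ### Encoding elements and tuples by positions and labels -/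

section Encoding

variable (L : FirstOrder.Language.{u, v}) (K N : ℕ)

/-- The label of a tuple: the colours of its components and the relations that contain it. -/
abbrev TupleLabel : Type v := (Fin N → Option (Fin K)) × Set (Σ n, L.Relations n)

/-- The label of an element of an incidence structure. -/
abbrev Label : Type v := Fin K ⊕ TupleLabel L K N

/-- The number of copies. -/
noncomputable def labelCount : ℕ := Nat.card (Label L K N) + 2

/-- The summand 2 ensures that the symbols for `∼` and for the single copies exist, which requires
at least two copies. -/
theorem two_le_labelCount : 2 ≤ labelCount L K N := Nat.le_add_left _ _

variable {L K N} [Finite (Σ n, L.Relations n)]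

/-- The copy that corresponds to a label. -/
noncomputable def labelIdx (l : Label L K N) : Fin (labelCount L K N) :=
  Fin.castLE (Nat.le_add_right _ _) (Finite.equivFin (Label L K N) l)

theorem labelIdx_injective : Function.Injective (labelIdx (L := L) (K := K) (N := N)) :=
  (Fin.castLE_injective _).comp (Finite.equivFin _).injective

variable (L K N) in
/-- The formula that defines the domain of the incidence structure. -/
noncomputable def decompDelta : MSO (decompLang K (labelCount L K N)) 1 :=
  MSO.any fun c : Fin (labelCount L K N) =>
    .conj (.rel (partRel (two_le_labelCount L K N) c) ![0]) (.rel (paramRel (Fin.castAdd K c)) ![0])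

/-- The formulae that define the relations of the incidence structure. -/
noncomputable def decompPhi : {n : ℕ} → IncRel L n → MSO (decompLang K (labelCount L K N)) n
  | _, .pred (n := n) R =>
    MSO.any fun l : {l : TupleLabel L K N // ⟨n, R⟩ ∈ l.2} =>
      .rel (partRel (two_le_labelCount L K N) (labelIdx (.inr l.1))) ![0]
  | _, .inc j _ =>
    MSO.any fun q : {q : Fin K × TupleLabel L K N // ∃ h : j < N, q.2.1 ⟨j, h⟩ = some q.1} =>
      .conj (.rel (partRel (two_le_labelCount L K N) (labelIdx (.inl q.1.1))) ![0]) <|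
      .conj (.rel (partRel (two_le_labelCount L K N) (labelIdx (.inr q.1.2))) ![1]) <|
      -- Equality of colours does not identify the component; connection inside the regions of that
      -- colour does. The last `K` parameters describe these regions.
      reachFormula (two_le_labelCount L K N) (Fin.natAdd _ q.1.1)

variable (L K N)

/-- The transduction that maps a tree to the incidence structures of all structures that have a
decomposition over this tree with bags of size at most `K`. -/
noncomputable def decompTransduction :
    Transduction (incLang FirstOrder.Language.graph) (incLang L) where
  params := labelCount L K N + K
  copies := labelCount L K N
  one_le_copies := (Nat.le_succ 1).trans (two_le_labelCount L K N)
  basic :=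
    { chi := .imp .falsum .falsum
      delta := decompDelta L K N
      phi := fun R => decompPhi R }

variable {L K N}

theorem incidence_mem_values (hN : ∀ R : Σ n, L.Relations n, R.1 ≤ N) {T : TreeDom}
    {A : FinStr.{u, v, w} L} (D : TreeDecomp T A) (hK : ∀ t, (D.bag t).ncard ≤ K) :
    A.incidence ∈ (decompTransduction L K N).values T.toFinStr.incidence := by
  classical
  obtain ⟨col, hcol⟩ := D.exists_colouring hK
  have hpos : ∀ a, ∃ t, a ∈ D.bag t := fun a => by
    obtain ⟨⟨t, ht⟩⟩ := (D.connected a).nonempty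
    exact ⟨t, ht⟩
  choose posA hposA using hpos
  have hposE : ∀ e : Tuples L A.carrier, ∃ t, ∀ i, e.1.2 i ∈ D.bag t := by
    rintro ⟨⟨n, c⟩, R, hR⟩
    exact D.covers R c hR
  choose posE hposE using hposE
  let labE : Tuples L A.carrier → TupleLabel L K N := fun e =>
    (fun j => if h : j.1 < e.1.1 then some (col (e.1.2 ⟨j, h⟩)) else none,
      {R | ∃ c, e.1 = ⟨R.1, c⟩ ∧ FirstOrder.Language.Structure.RelMap R.2 c})
  let g : A.carrier ⊕ Tuples L A.carrier → T.Inc × Fin (labelCount L K N) :=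
    Sum.elim (fun a => (.inl (posA a), labelIdx (.inl (col a))))
      (fun e => (.inl (posE e), labelIdx (.inr (labE e))))
  have hg : Function.Injective g := by
    rintro (a | e) (a' | e') h
    · obtain ⟨h1, h2⟩ := Prod.mk.inj h
      refine congrArg Sum.inl (hcol (posA a) a (hposA a) a' ?_ (Sum.inl_injective
        (labelIdx_injective h2)))
      rw [Sum.inl_injective h1]
      exact hposA a'
    · cases labelIdx_injective (Prod.mk.inj h).2
    · cases labelIdx_injective (Prod.mk.inj h).2
    · obtain ⟨h1, h2⟩ := Prod.mk.inj h
      have h1 : posE e = posE e' := Sum.inl_injective h1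
      obtain ⟨h3, h4⟩ := Prod.mk.inj (Sum.inr_injective (labelIdx_injective h2))
      have hp := hposE e
      have hp' := hposE e'
      rw [← h1] at hp'
      generalize posE e = t at hp hp'
      obtain ⟨⟨n, c⟩, R, hR⟩ := e
      -- The label of a tuple contains at least one relation symbol, and this fixes the arity. The
      -- colours then fix the components, as both tuples lie in the same bag.
      have hmem : (⟨n, R⟩ : Σ n, L.Relations n) ∈
          (labE ⟨⟨n, c⟩, R, hR⟩).2 := ⟨c, rfl, hR⟩
      rw [show (labE ⟨⟨n, c⟩, R, hR⟩).2 = (labE e').2 from h4] at hmem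
      obtain ⟨c', hc', -⟩ := hmem
      obtain ⟨⟨n', c''⟩, he'⟩ := e'
      obtain ⟨rfl, hc'⟩ := Sigma.mk.inj hc'
      refine congrArg Sum.inr (Subtype.ext (congrArg (Sigma.mk n') (funext fun j => ?_)))
      refine hcol t _ (hp j) _ (hp' j) ?_
      have := congrFun h3 ⟨j, j.2.trans_le (hN ⟨_, R⟩)⟩
      simpa using this
  -- The first block marks the positions used in each copy. The second consists of complements of
  -- regions, so that avoiding a parameter, a negated atom, means lying in the regions of that
  -- colour.
  let Q : Fin (labelCount L K N + K) → Set T.Inc :=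
    Fin.addCases (motive := fun _ => Set T.Inc) (fun c => {z | (z, c) ∈ Set.range g})
      (fun i => {z | ¬ ∃ b, col b = i ∧ z ∈ D.region b})
  have hQ : ∀ c, Q (Fin.castAdd K c) = {z | (z, c) ∈ Set.range g} := fun c =>
    Fin.addCases_left (motive := fun _ => Set T.Inc) c
  have hQ' : ∀ i, Q (Fin.natAdd _ i) = {z | ¬ ∃ b, col b = i ∧ z ∈ D.region b} := fun i =>
    Fin.addCases_right (motive := fun _ => Set T.Inc) i
  have hdelta : ∀ m : (T.copies (labelCount L K N) Q).carrier,
      (decompDelta L K N).Realize (A := (T.copies (labelCount L K N) Q).carrier)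
        (fun _ => {m}) ↔ m ∈ Set.range g := by
    intro m
    refine (MSO.realize_any _ _).trans ?_
    simp only [MSO.realize_conj, realize_param, realize_part, hQ, Set.mem_singleton_iff]
    constructor
    · rintro ⟨c, ⟨m', rfl, rfl⟩, m'', h, rfl⟩
      exact h
    · intro h
      exact ⟨m.2, ⟨m, rfl, rfl⟩, m, h, rfl⟩
  refine ⟨Q, fun h => h, ⟨FirstOrder.Language.Equiv.symm ⟨?_, (fun f => nomatch f), ?_⟩⟩⟩
  · exact (Equiv.ofInjective g hg).trans (Equiv.subtypeEquivRight fun m => (hdelta m).symm)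
  · intro n R x
    cases R with
    | pred R =>
      rename_i n
      change (decompPhi (N := N) (IncRel.pred R)).Realize (A := (T.copies (labelCount L K N) Q).carrier)
        (fun i => {g (x i)}) ↔ _
      refine (MSO.realize_any _ _).trans ?_
      constructor
      · rintro ⟨⟨l, hl⟩, h⟩
        obtain ⟨m, hm, hm'⟩ := (realize_part Q _ _ _ _).mp h
        obtain rfl : m = g (x 0) := hm'
        rcases hx : x 0 with a | e
        · rw [hx] at hm
          cases labelIdx_injective hm
        · rw [hx] at hm
          obtain rfl : labE e = l := Sum.inr_injective (labelIdx_injective hm)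
          obtain ⟨c, hc, hR⟩ := hl
          exact ⟨e, c, hx, hc, hR⟩
      · rintro ⟨e, c, h0, h1, h2⟩
        refine ⟨⟨labE e, c, h1, h2⟩, (realize_part Q _ _ _ _).mpr ⟨g (x 0), ?_, rfl⟩⟩
        rw [h0]
        rfl
    | inc j hj =>
      change (decompPhi (N := N) (IncRel.inc j hj)).Realize (A := (T.copies (labelCount L K N) Q).carrier)
        (fun i => {g (x i)}) ↔ _
      refine (MSO.realize_any _ _).trans ?_
      have hs : (fun i => {g (x i)} : Fin 2 → Set (T.copies (labelCount L K N) Q).carrier) =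
          ![{g (x 0)}, {g (x 1)}] := by
        ext i
        fin_cases i <;> rfl
      have hreach : ∀ (a : A.carrier) (e : Tuples L A.carrier) (h : j < e.1.1),
          col a = col (e.1.2 ⟨j, h⟩) →
          ((reachFormula (two_le_labelCount L K N) (Fin.natAdd _ (col (e.1.2 ⟨j, h⟩)))).Realize
            (A := (T.copies (labelCount L K N) Q).carrier) ![{g (.inl a)}, {g (.inr e)}] ↔
            a = e.1.2 ⟨j, h⟩) := fun a e h hc =>
        TreeDecomp.realize_reachFormula (D := D) _ Q _ col hcol hc (hQ' _) (hposA a)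
          (hposE e ⟨j, h⟩) _ _
      constructor
      · rintro ⟨⟨⟨i, l⟩, hjN, hl⟩, h⟩
        obtain ⟨h1, h⟩ := (MSO.realize_conj _ _ _).mp h
        obtain ⟨h2, h3⟩ := (MSO.realize_conj _ _ _).mp h
        obtain ⟨m, hm, hm'⟩ := (realize_part Q _ _ _ _).mp h1
        obtain rfl : m = g (x 0) := hm'
        obtain ⟨m, hm2, hm'⟩ := (realize_part Q _ _ _ _).mp h2
        obtain rfl : m = g (x 1) := hm'
        rw [hs] at h3
        rcases hx : x 0 with a | e
        · rcases hx' : x 1 with a' | e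
          · rw [hx'] at hm2
            cases labelIdx_injective hm2
          · rw [hx] at hm h3
            rw [hx'] at hm2 h3
            obtain rfl : labE e = l := Sum.inr_injective (labelIdx_injective hm2)
            have hi : col a = i := Sum.inl_injective (labelIdx_injective hm)
            have hje : j < e.1.1 := by
              by_contra hje
              simp [labE, hje] at hl
            have hl : col (e.1.2 ⟨j, hje⟩) = i := by
              simpa [labE, hje] using hl
            subst hl
            exact ⟨a, e, hje, hx, hx', (hreach a e hje hi).mp h3⟩
        · rw [hx] at hm
          cases labelIdx_injective hm
      · rintro ⟨a, e, h, h0, h1, h2⟩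
        have hjN : j < N := by
          obtain ⟨R, -⟩ := e.2
          exact h.trans_le (hN ⟨_, R⟩)
        refine ⟨⟨⟨col (e.1.2 ⟨j, h⟩), labE e⟩, hjN, by simp [labE, h]⟩, ?_⟩
        refine (MSO.realize_conj _ _ _).mpr ⟨(realize_part Q _ _ _ _).mpr ⟨g (x 0), ?_, rfl⟩,
          (MSO.realize_conj _ _ _).mpr ⟨(realize_part Q _ _ _ _).mpr ⟨g (x 1), ?_, rfl⟩, ?_⟩⟩
        · rw [h0, h2]
          rfl
        · rw [h1]
          rfl
        · rw [hs, h0, h1]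
          exact (hreach a e h (congrArg col h2)).mpr h2

end Encoding

/-! ### Classes of bounded width -/

theorem belowIn_of_treeDecomp (L : FirstOrder.Language.{u, v})
    [Finite (Σ n, L.Relations n)] (C : Set (FinStr.{u, v, w} L)) (𝒯 : Set TreeDom) (K : ℕ)
    (h : ∀ A ∈ C, ∃ T ∈ 𝒯, ∃ D : TreeDecomp T A, ∀ t, (D.bag t).ncard ≤ K) :
    BelowIn C (TreeDom.toFinStr '' 𝒯) := by
  obtain ⟨N, hN⟩ := (Set.finite_range (fun R : Σ n, L.Relations n => R.1)).bddAbove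
  refine ⟨decompTransduction L K N, ?_⟩
  rintro _ ⟨A, hA, rfl⟩
  obtain ⟨T, hT, D, hD⟩ := h A hA
  exact Set.mem_biUnion ⟨_, ⟨T, hT, rfl⟩, rfl⟩ (incidence_mem_values (fun R => hN ⟨R, rfl⟩) D hD)

theorem belowIn_iff (L : FirstOrder.Language.{u, v})
    [Finite (Σ n, L.Relations n)] (C : Set (FinStr.{u, v, w} L)) (𝒯 : Set TreeDom) :
    BelowIn C (TreeDom.toFinStr '' 𝒯) ↔
      ∃ K : ℕ, ∀ A ∈ C, ∃ T ∈ 𝒯, ∃ D : TreeDecomp T A, ∀ t, (D.bag t).ncard ≤ K :=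
  ⟨exists_treeDecomp_of_belowIn L C 𝒯, fun ⟨K, h⟩ => belowIn_of_treeDecomp L C 𝒯 K h⟩

theorem natCast_sub_one_eq_coe (n : ℕ) : (n : EReal) - 1 = ((n - 1 : ℝ) : EReal) := by
  rw [EReal.coe_sub, EReal.coe_natCast, EReal.coe_one]

/-- In `EReal` an empty bag contributes `-1` and the empty tree has width `⊥`; both count as
bounded. -/
theorem iSup_width_lt_top_iff {L : FirstOrder.Language.{u, v}} (C : Set (FinStr.{u, v, w} L))
    (P : TreeDom → Prop) :
    (⨆ A ∈ C, ⨅ (T : TreeDom) (_ : P T) (D : TreeDecomp T A), D.width) < ⊤ ↔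
      ∃ K : ℕ, ∀ A ∈ C, ∃ T, P T ∧ ∃ D : TreeDecomp T A, ∀ t, (D.bag t).ncard ≤ K := by
  constructor
  · intro h
    -- A real number strictly above the supremum turns each infimum into an actual decomposition of
    -- width below it.
    obtain ⟨x, hx, -⟩ := EReal.lt_iff_exists_real_btwn.mp h
    obtain ⟨K, hK⟩ := exists_nat_ge x
    refine ⟨K + 1, fun A hA => ?_⟩
    have hA' := (le_iSup₂ (f := fun A (_ : A ∈ C) =>
      ⨅ (T : TreeDom) (_ : P T) (D : TreeDecomp T A), D.width) A hA).trans_lt hx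
    simp only [iInf_lt_iff] at hA'
    obtain ⟨T, hT, D, hD⟩ := hA'
    refine ⟨T, hT, D, fun t => ?_⟩
    have h1 : (((D.bag t).ncard : EReal) - 1) < x :=
      (le_iSup (fun t => (((D.bag t).ncard : EReal) - 1)) t).trans_lt hD
    rw [natCast_sub_one_eq_coe, EReal.coe_lt_coe_iff] at h1
    have h3 : ((D.bag t).ncard : ℝ) < (K + 1 : ℕ) := by
      push_cast
      linarith
    exact (Nat.cast_lt.mp h3).le
  · rintro ⟨K, h⟩
    refine lt_of_le_of_lt (iSup₂_le fun A hA => ?_) (EReal.coe_lt_top (K : ℝ))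
    obtain ⟨T, hT, D, hD⟩ := h A hA
    refine (iInf₂_le T hT).trans ((iInf_le _ D).trans (iSup_le fun t => ?_))
    have h1 : (((D.bag t).ncard : ℝ) - 1) ≤ K := by
      have : ((D.bag t).ncard : ℝ) ≤ K := Nat.cast_le.mpr (hD t)
      linarith
    rwa [natCast_sub_one_eq_coe, EReal.coe_le_coe_iff]

/-- A decomposition can be extended to a larger tree by empty bags. -/
theorem TreeDecomp.exists_extend {L : FirstOrder.Language.{u, v}} {T T' : TreeDom}
    {A : FinStr.{u, v, w} L} (D : TreeDecomp T A) (h : T.verts ⊆ T'.verts) {K : ℕ}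
    (hK : ∀ t, (D.bag t).ncard ≤ K) :
    ∃ D' : TreeDecomp T' A, ∀ t, (D'.bag t).ncard ≤ K := by
  refine ⟨⟨fun t => {a | ∃ ht : t.1 ∈ T.verts, a ∈ D.bag ⟨t.1, ht⟩}, fun a => ?_,
    fun R c hc => ?_⟩, fun t => ?_⟩
  · let f : T.graph.induce {t | a ∈ D.bag t} →g
        T'.graph.induce {t | a ∈ {a | ∃ ht : t.1 ∈ T.verts, a ∈ D.bag ⟨t.1, ht⟩}} :=
      { toFun := fun t => ⟨⟨t.1.1, h t.1.2⟩, t.1.2, t.2⟩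
        map_rel' := by
          rintro ⟨x, hx⟩ ⟨y, hy⟩ hxy
          simp only [SimpleGraph.comap_adj, Function.Embedding.subtype_apply, TreeDom.graph,
            SimpleGraph.fromRel_adj] at hxy ⊢
          refine ⟨fun e => hxy.1 (Subtype.ext (Subtype.mk.inj e)), hxy.2⟩ }
    -- The new bags are empty, so the vertices carrying `a` are the old ones and `f` is surjective.
    refine (D.connected a).map f ?_
    rintro ⟨⟨t, ht'⟩, ht, ha⟩
    exact ⟨⟨⟨t, ht⟩, ha⟩, rfl⟩
  · obtain ⟨t, ht⟩ := D.covers R c hc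
    exact ⟨⟨t.1, h t.2⟩, fun i => ⟨t.2, ht i⟩⟩
  · by_cases ht : t.1 ∈ T.verts
    · refine le_of_eq_of_le ?_ (hK ⟨t.1, ht⟩)
      congr 1
      ext a
      exact ⟨fun ⟨_, h⟩ => h, fun h => ⟨ht, h⟩⟩
    · have : {a | ∃ ht : t.1 ∈ T.verts, a ∈ D.bag ⟨t.1, ht⟩} = ∅ := by
        ext a
        simp [ht]
      simp [this]

/-! ### Trees of bounded height inside complete trees -/

theorem TreeDom.mem_complete {m n : ℕ} {x : List ℕ} :
    x ∈ (TreeDom.complete m n).verts ↔ x.length < n ∧ ∀ d ∈ x, d < m := by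
  simp only [TreeDom.complete, Set.Finite.mem_toFinset, Set.mem_image, Set.mem_ofPred_eq]
  constructor
  · rintro ⟨l, hl, rfl⟩
    refine ⟨by simpa using hl, fun d hd => ?_⟩
    obtain ⟨i, -, rfl⟩ := List.mem_map.mp hd
    exact i.2
  · rintro ⟨h1, h2⟩
    exact ⟨x.pmap Fin.mk h2, by simpa using h1, by simp [List.map_pmap]⟩

theorem TreeDom.height_complete_le (m n : ℕ) : (TreeDom.complete m n).height ≤ n :=
  Finset.sup_le fun _ hx => (TreeDom.mem_complete.mp hx).1

theorem TreeDom.exists_subset_complete (T : TreeDom) {n : ℕ} (h : T.height ≤ n) :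
    ∃ m, T.verts ⊆ (TreeDom.complete m n).verts := by
  -- Every entry of a sequence is at most its sum, so the largest sum plus one bounds all branching
  -- labels strictly.
  refine ⟨T.verts.sup fun x => x.sum + 1, fun x hx => TreeDom.mem_complete.mpr ⟨?_, fun d hd => ?_⟩⟩
  · exact (Finset.le_sup (f := fun x : List ℕ => x.length + 1) hx).trans h
  · exact (Nat.lt_succ_of_le (List.single_le_sum (by simp) d hd)).trans_le
      (Finset.le_sup (f := fun x : List ℕ => x.sum + 1) hx)

end TransductionHierarchy

theorem mainTheorem3 (L : FirstOrder.Language.{u, v}) [L.IsRelational]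
    [Finite (Σ n, L.Relations n)] (C : Set (FinStr.{u, v, w} L)) :
    (BelowIn C allPaths ↔ pwdClass C < ⊤) ∧
    (BelowIn C allTrees ↔ twdClass C < ⊤) ∧
    (∀ n : ℕ, BelowIn C (treesOfHeight n) ↔ twdDepthClass n C < ⊤) := by
  refine ⟨?_, ?_, fun n => ?_⟩
  · exact (belowIn_iff L C {T | T.IsPath}).trans (iSup_width_lt_top_iff C TreeDom.IsPath).symm
  · have h := iSup_width_lt_top_iff C fun _ => True
    simp only [iInf_true] at h
    refine Iff.trans ?_ h.symm
    rw [allTrees, ← Set.image_univ]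
    exact belowIn_iff L C Set.univ
  · refine Iff.trans ?_ (iSup_width_lt_top_iff C fun T => T.height ≤ n).symm
    rw [treesOfHeight, show (fun m => (TreeDom.complete m n).toFinStr) =
      TreeDom.toFinStr ∘ fun m => TreeDom.complete m n from rfl, Set.range_comp, belowIn_iff]
    refine exists_congr fun K => forall₂_congr fun A _ => ⟨?_, ?_⟩
    · rintro ⟨-, ⟨m, rfl⟩, D, hD⟩
      exact ⟨_, TreeDom.height_complete_le m n, D, hD⟩
    · rintro ⟨T, hT, D, hD⟩
      obtain ⟨m, hm⟩ := T.exists_subset_complete hT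
      obtain ⟨D', hD'⟩ := D.exists_extend hm hD
      exact ⟨_, ⟨m, rfl⟩, D', hD'⟩
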